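/- **Theorem (conditional CLT for bootstrap $u$- and $v$-statistics).** Let $X_1,X_2,\dots$ be i.i.d. real random variables and let $h:\mathbb R^2\to\mathbb R$ be measurable and symmetric. For $n\ge 2$ put $$U_n=\frac1{n(n-1)}\sum_{1\le i\ne j\le n}h(X_i,X_j),\qquad V_n=\frac1{n^2}\sum_{1\le i,j\le n}h(X_i,X_j).$$ Draw $m$ indices $I_1,\dots,I_m$ uniformly with replacement from $\{1,\dots,n\}$, independently of the $X$'s, let $X^*_s=X_{I_s}$, and let $w_i=w^{(n)}_i$ be the number of times the index $i$ is drawn, so that $(w_1,\dots,w_n)$ is multinomial$(m;\frac1n,\dots,\frac1n)$. Put $$U^*_{n,m}=\frac{1}{m(m-1)}\sum_{\substack{1\le s\neq t\le m\\ I_s\ne I_t}}h(X^*_s,X^*_t)=\frac{1}{m(m-1)}\sum_{1\le i\ne j\le n}w_iw_j\,h(X_i,X_j),$$ $$V^*_{n,m}=\frac{1}{m(m-1)}\sum_{1\le i,j\le n}w_iw_j\,h(X_i,X_j).$$ Let $$\hat\sigma_n^2=\frac{n-1}{4}\sum_{i=1}^n\big(U^{i}_{n-1}-U_n\big)^2,\qquad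 U^i_{n-1}=\binom{n-1}{2}^{-1}\sum_{\substack{1\le j_1<j_2\le n\\ j_1,j_2\ne i}}h(X_{j_1},X_{j_2}),$$ be the jackknife estimator of $\sigma^2=\operatorname{Var}(\tilde h(X_1))$, where $\tilde h(X_1)=E\big(h(X_1,X_2)-E h(X_1,X_2)\,\big|\,X_1\big)$. Assume that the statistics are non-degenerate, i.e. that $\tilde h(X_1)$ is not almost surely $0$. Let $P_{X|w}$ denote conditional probability given the weights $(w_1,\dots,w_n)$, let $P_w$ be the law of the weights, and let $\Phi$ be the standard normal distribution function. (a) If $E h^2(X_1,X_2)<\infty$, then for all $t\in\mathbb R$, as $m,n\to\infty$ in such a way that $m=o(n^2)$, $$P_{X|w}\left(\frac{U^*_{n,m}-U_n}{2\,\hat\sigma_n\sqrt{\sum_{i=1}^n\big(\frac{w_i}{m}-\frac1n\big)^2}}\le t\right)\longrightarrow\Phi(t)\quad\text{in probability-}P_w .$$ (b) If $E h^2(X_1,X_2)<\infty$ and $E h^2(X_1,X_1)<\infty$, then for all $t\in\mathbb R$, as $m,n\to\infty$ in such a way that $m=o(n^2)$, $$P_{X|w}\left(\frac{V^*_{n,m}-V_n}{2\,\hat\sigma_n\sqrt{\sum_{i=1}^n\big(\frac{w_i}{m}-\frac1n\big)^2}}\le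 t\right)\longrightarrow\Phi(t)\quad\text{in probability-}P_w ,$$ and the same holds when $V^*_{n,m}$ is replaced by $\frac{1}{m(m-1)}\sum_{1\le s\ne t\le m}h(X^*_s,X^*_t)$. -/

import Mathlib

open MeasureTheory ProbabilityTheory Filter Topology

namespace BootstrapU

noncomputable section

/-- The `u`-statistic `U_n = (1 / (n (n - 1))) ∑_{i ≠ j} h (x_i, x_j)` of order 2. -/
def uStat (h : ℝ → ℝ → ℝ) {n : ℕ} (x : Fin n → ℝ) : ℝ :=
  (∑ p : Fin n × Fin n with p.1 ≠ p.2, h (x p.1) (x p.2)) / ((n : ℝ) * ((n : ℝ) - 1))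

/-- The `v`-statistic `V_n = (1 / n²) ∑_{i, j} h (x_i, x_j)` of order 2. -/
def vStat (h : ℝ → ℝ → ℝ) {n : ℕ} (x : Fin n → ℝ) : ℝ :=
  (∑ i : Fin n, ∑ j : Fin n, h (x i) (x j)) / (n : ℝ) ^ 2

/-- The `u`-statistic of the `n - 1` observations that remain when the `i`-th is deleted. -/
def uStatDelete (h : ℝ → ℝ → ℝ) {n : ℕ} (x : Fin n → ℝ) (i : Fin n) : ℝ :=
  (∑ p : Fin n × Fin n with p.1 < p.2 ∧ p.1 ≠ i ∧ p.2 ≠ i, h (x p.1) (x p.2)) /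
    ((n - 1).choose 2 : ℝ)

/-- The jackknife estimator `((n - 1) / 4) ∑_i (U_{n-1}^i - U_n)²` of the variance of the
projection of the kernel, i.e. `n / 4` times the jackknife estimator of the variance of `U_n`. -/
def jackknifeVar (h : ℝ → ℝ → ℝ) {n : ℕ} (x : Fin n → ℝ) : ℝ :=
  ((n : ℝ) - 1) / 4 * ∑ i : Fin n, (uStatDelete h x i - uStat h x) ^ 2

/-- The bootstrap weight `w_i`: the number of times the index `i` is chosen in the draws `d`.
If `d` is uniform on `Fin m → Fin n`, then `w` is multinomial `(m; 1/n, …, 1/n)`. -/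
def weight {n m : ℕ} (d : Fin m → Fin n) (i : Fin n) : ℕ :=
  Fintype.card {s : Fin m // d s = i}

/-- The bootstrap `u`-statistic of the bootstrap sample `x (d 1), …, x (d m)`: the sum runs over
the pairs of draws that choose two different observations. -/
def bootU (h : ℝ → ℝ → ℝ) {n m : ℕ} (x : Fin n → ℝ) (d : Fin m → Fin n) : ℝ :=
  (∑ p : Fin m × Fin m with p.1 ≠ p.2 ∧ d p.1 ≠ d p.2, h (x (d p.1)) (x (d p.2))) /
    ((m : ℝ) * ((m : ℝ) - 1))

/-- The bootstrap `v`-statistic `∑_{i, j} w_i w_j h (x_i, x_j) / (m (m - 1))`. -/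
def bootV (h : ℝ → ℝ → ℝ) {n m : ℕ} (x : Fin n → ℝ) (d : Fin m → Fin n) : ℝ :=
  (∑ i : Fin n, ∑ j : Fin n, (weight d i : ℝ) * (weight d j : ℝ) * h (x i) (x j)) /
    ((m : ℝ) * ((m : ℝ) - 1))

/-- The bootstrap `v`-statistic without the pairs of a draw with itself,
`∑_{s ≠ t} h (x*_s, x*_t) / (m (m - 1))`, where `x*_s = x (d s)`. -/
def bootV' (h : ℝ → ℝ → ℝ) {n m : ℕ} (x : Fin n → ℝ) (d : Fin m → Fin n) : ℝ :=
  (∑ p : Fin m × Fin m with p.1 ≠ p.2, h (x (d p.1)) (x (d p.2))) /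
    ((m : ℝ) * ((m : ℝ) - 1))

/-- The Studentizing factor `2 σ̂_n √(∑_t (w_t / m - 1 / n)²)`. -/
def normalizer (h : ℝ → ℝ → ℝ) {n m : ℕ} (x : Fin n → ℝ) (d : Fin m → Fin n) : ℝ :=
  2 * Real.sqrt (jackknifeVar h x) *
    Real.sqrt (∑ t : Fin n, ((weight d t : ℝ) / (m : ℝ) - 1 / (n : ℝ)) ^ 2)

variable {Ω : Type*} [MeasurableSpace Ω]

/-- Non-degeneracy: for `i ≠ j` the projection
`E (h (X_i, X_j) - E h (X_i, X_j) | X_i)` does not vanish almost surely. -/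
def NonDegenerate (μ : Measure Ω) (h : ℝ → ℝ → ℝ) (X : ℕ → Ω → ℝ) : Prop :=
  ∀ i j : ℕ, i ≠ j →
    ¬ (μ[fun ω => h (X i ω) (X j ω) - ∫ ω', h (X i ω') (X j ω') ∂μ |
        MeasurableSpace.comap (X i) inferInstance] =ᵐ[μ] 0)

/-- The first `n` observations. -/
def sample (X : ℕ → Ω → ℝ) (n : ℕ) (ω : Ω) : Fin n → ℝ := fun i => X i ω

/-- The sub-σ-algebra of `Ω` generated by the bootstrap weights. -/
@[reducible] def sigmaWeights {n m : ℕ} (D : Ω → Fin m → Fin n) : MeasurableSpace Ω :=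
  MeasurableSpace.comap (fun ω => weight (D ω)) inferInstance

end

end BootstrapU

/-! Write `h` as its mean, plus the projection `g` in each variable, plus a completely degenerate
part (Hoeffding). For fixed weights of total `m`, `√m (U* - U_n)` then equals `2 ∑ c_i g(X_i)` with
`c_i = (w_i - m/n)/√m`, plus remainders. A remainder coming from `U*` is at most a constant times
`√m ∑ w_i² / (m(m-1))` in `L¹`, and the one from `U_n` is of order `√m/n`. Since `∑ w_i²` is about
`m + m²/n`, everything is of order `1/√m + √m/n`, which vanishes when `m = o(n²)`. For the
degenerate part the bound rests on orthogonality: `deg(X_i, X_j)` is uncorrelated with every pair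
other than itself and its swap.

If `∑ c_i² → 1` and `∑ c_i⁴ → 0`, all `c_i` are uniformly small, and comparing characteristic
functions gives `∑ c_i g(X_i)/σ → N(0,1)` (`tendstoInDistribution_weighted_sum`). The jackknife
estimator is an affine image of the empirical variance of the row sums of `h`, hence consistent
(`tendstoInMeasure_sqrt_jackknifeVar`). Slutsky's theorem gives the limit for deterministic weights
(`tendsto_measureReal_studentized`). The diagonal terms of the `v`-statistics obey the same bounds
(`tendstoInMeasure_diag`).

For random weights, a recursion over the draws bounds the mean of `weightDefect` by `9/n + 1/m`. By
independence, the conditional probability given the weights is the deterministic-weight probability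
evaluated at the drawn weights. Every subsequence has a further one along which almost every
realization of the weights is regular, so the deterministic theorem gives convergence there, and
hence convergence in probability (`tendstoInMeasure_condExp_studentized`). -/

namespace BootstrapU

/-! ### Convergence in measure and conditioning on an independent variable. -/

section Tools

variable {Ω : Type*} [MeasurableSpace Ω] {μ : Measure Ω}

/-- Markov's inequality. Every remainder below is controlled through `L¹` bounds of this kind, valid
only once the sample sizes are large enough. -/
lemma tendstoInMeasure_zero_of_integral_abs_le {R : ℕ → Ω → ℝ} {b : ℕ → ℝ}
    (hR : ∀ᶠ k in atTop, Integrable (R k) μ ∧ ∫ ω, |R k ω| ∂μ ≤ b k)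
    (hb : Tendsto b atTop (𝓝 0)) : TendstoInMeasure μ R atTop (fun _ => 0) := by
  rw [tendstoInMeasure_iff_norm]
  intro ε hε
  have h1 : Tendsto (fun k => ENNReal.ofReal (b k / ε)) atTop (𝓝 0) := by
    have := ENNReal.tendsto_ofReal (hb.div_const ε)
    simpa using this
  refine tendsto_of_tendsto_of_tendsto_of_le_of_le' tendsto_const_nhds h1
    (Eventually.of_forall fun _ => zero_le) ?_
  filter_upwards [hR] with k hk
  obtain ⟨hi, hk⟩ := hk
  have h2 := meas_ge_le_lintegral_div (μ := μ) (f := fun ω => ENNReal.ofReal |R k ω|)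
    (hi.abs.aemeasurable.ennreal_ofReal) (ε := ENNReal.ofReal ε) (by simpa using hε) (by simp)
  rw [← ofReal_integral_eq_lintegral_ofReal hi.abs (ae_of_all _ fun _ => abs_nonneg _)] at h2
  calc μ {x | ε ≤ ‖R k x - 0‖} ≤ μ {x | ENNReal.ofReal ε ≤ ENNReal.ofReal |R k x|} := by
        refine measure_mono fun x hx => ?_
        simp only [Set.mem_ofPred_eq, sub_zero, Real.norm_eq_abs] at hx ⊢
        exact ENNReal.ofReal_le_ofReal hx
    _ ≤ _ := h2
    _ = ENNReal.ofReal ((∫ ω, |R k ω| ∂μ) / ε) := (ENNReal.ofReal_div_of_pos hε).symm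
    _ ≤ _ := ENNReal.ofReal_le_ofReal (by gcongr)

lemma integral_abs_le_sqrt [IsProbabilityMeasure μ] {f : Ω → ℝ} (hf : MemLp f 2 μ) {b : ℝ}
    (hb : ∫ ω, f ω ^ 2 ∂μ ≤ b) : ∫ ω, |f ω| ∂μ ≤ √b := by
  have h1 : Integrable (fun ω => |f ω|) μ := (hf.integrable (by norm_num)).abs
  have h2 : Integrable (fun ω => f ω ^ 2) μ := hf.integrable_sq
  refine Real.le_sqrt_of_sq_le (le_trans ?_ hb)
  have := variance_nonneg |f| μ
  rw [variance_eq_sub hf.abs] at this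
  simpa using this

lemma tendstoInMeasure_add_zero {F G : ℕ → Ω → ℝ}
    (hF : TendstoInMeasure μ F atTop (fun _ => 0)) (hG : TendstoInMeasure μ G atTop (fun _ => 0)) :
    TendstoInMeasure μ (fun k ω => F k ω + G k ω) atTop (fun _ => 0) := by
  rw [tendstoInMeasure_iff_norm] at *
  intro ε hε
  have h := (hF (ε / 2) (by positivity)).add (hG (ε / 2) (by positivity))
  rw [add_zero] at h
  refine tendsto_of_tendsto_of_tendsto_of_le_of_le tendsto_const_nhds h
    (fun _ => zero_le) fun k => ?_
  refine (measure_mono fun x hx => ?_).trans (measure_union_le _ _)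
  simp only [Set.mem_ofPred_eq, sub_zero, Real.norm_eq_abs, Set.mem_union] at *
  by_contra! hc
  have := abs_add_le (F k x) (G k x)
  linarith [hc.1, hc.2]

lemma tendstoInMeasure_const_of_tendsto {a : ℕ → ℝ} {c : ℝ} (ha : Tendsto a atTop (𝓝 c)) :
    TendstoInMeasure μ (fun k (_ : Ω) => a k) atTop (fun _ => c) := by
  rw [tendstoInMeasure_iff_norm]
  intro ε hε
  refine tendsto_const_nhds.congr' ?_
  filter_upwards [Metric.tendsto_nhds.1 ha ε hε] with k hk
  rw [Real.dist_eq] at hk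
  simp [Real.norm_eq_abs, not_le.2 hk]

lemma TendstoInMeasure.comp_continuousAt {E F : Type*} [PseudoMetricSpace E] [PseudoMetricSpace F]
    {G : ℕ → Ω → E} {c : E} {f : E → F} (hG : TendstoInMeasure μ G atTop (fun _ => c))
    (hf : ContinuousAt f c) :
    TendstoInMeasure μ (fun k ω => f (G k ω)) atTop (fun _ => f c) := by
  rw [tendstoInMeasure_iff_dist] at *
  intro ε hε
  obtain ⟨δ, hδ, h⟩ := Metric.continuousAt_iff.1 hf ε hε
  refine tendsto_of_tendsto_of_tendsto_of_le_of_le tendsto_const_nhds (hG δ hδ)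
    (fun _ => zero_le) fun k => measure_mono fun x hx => ?_
  simp only [Set.mem_ofPred_eq] at *
  by_contra! hc
  exact absurd (h hc) (not_lt.2 hx)

lemma TendstoInMeasure.prodMk_const {E F : Type*} [PseudoMetricSpace E] [PseudoMetricSpace F]
    {G : ℕ → Ω → E} {H : ℕ → Ω → F} {c : E} {d : F}
    (hG : TendstoInMeasure μ G atTop (fun _ => c)) (hH : TendstoInMeasure μ H atTop (fun _ => d)) :
    TendstoInMeasure μ (fun k ω => (G k ω, H k ω)) atTop (fun _ => (c, d)) := by
  rw [tendstoInMeasure_iff_dist] at *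
  intro ε hε
  have h := (hG ε hε).add (hH ε hε)
  rw [add_zero] at h
  refine tendsto_of_tendsto_of_tendsto_of_le_of_le tendsto_const_nhds h
    (fun _ => zero_le) fun k => ?_
  refine (measure_mono fun x hx => ?_).trans (measure_union_le _ _)
  simpa [Prod.dist_eq] using hx

/-- Squeeze: if `|A k - B k| ≤ C k` with `B k → c` and `C k → 0` in measure, then `A k → c`. -/
lemma tendstoInMeasure_of_abs_sub_le {A B C : ℕ → Ω → ℝ} {c : ℝ}
    (hB : TendstoInMeasure μ B atTop (fun _ => c)) (hC : TendstoInMeasure μ C atTop (fun _ => 0))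
    (h : ∀ᶠ k in atTop, ∀ ω, |A k ω - B k ω| ≤ C k ω) :
    TendstoInMeasure μ A atTop (fun _ => c) := by
  rw [tendstoInMeasure_iff_norm] at *
  intro ε hε
  have h' := (hB (ε / 2) (by positivity)).add (hC (ε / 2) (by positivity))
  rw [add_zero] at h'
  refine tendsto_of_tendsto_of_tendsto_of_le_of_le' tendsto_const_nhds h'
    (Eventually.of_forall fun _ => zero_le) ?_
  filter_upwards [h] with k hk
  refine (measure_mono fun x hx => ?_).trans (measure_union_le _ _)
  simp only [Set.mem_ofPred_eq, sub_zero, Real.norm_eq_abs, Set.mem_union] at *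
  by_contra! hc
  have h1 := abs_add_le (A k x - B k x) (B k x - c)
  have h2 := hk x
  have h3 := le_abs_self (C k x)
  rw [sub_add_sub_cancel] at h1
  linarith [hc.1, hc.2]

/-- The Gaussian law has no atoms, so the frontier of `Set.Iic t` is a null set for every `t`. -/
lemma tendsto_measureReal_le_of_tendstoInDistribution [IsProbabilityMeasure μ] {Y : ℕ → Ω → ℝ}
    (hY : TendstoInDistribution Y atTop (id : ℝ → ℝ) (fun _ => μ) (gaussianReal 0 1)) (t : ℝ) :
    Tendsto (fun k => μ.real {ω | Y k ω ≤ t}) atTop (𝓝 (cdf (gaussianReal 0 1) t)) := by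
  have : NullSingletonClass (gaussianReal 0 1) := nullSingletonClass_gaussianReal one_ne_zero
  have h := ProbabilityMeasure.tendsto_measure_of_null_frontier_of_tendsto' hY.tendsto
    (E := Set.Iic t) (by simp [measure_singleton])
  rw [cdf_eq_real]
  have h' := (ENNReal.tendsto_toReal (by simp [measure_ne_top])).comp h
  simp only [ProbabilityMeasure.coe_mk, Measure.map_id] at h'
  refine h'.congr fun k => ?_
  simp only [Function.comp_apply, Measure.real]
  rw [Measure.map_apply_of_aemeasurable (hY.forall_aemeasurable k) measurableSet_Iic]
  rfl

/-- The conditional expectation of a function of two independent variables given the first one is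
obtained by integrating out the second one. -/
lemma condExp_prod_of_indepFun [IsProbabilityMeasure μ] {α β : Type*} [MeasurableSpace α]
    [MeasurableSpace β] [StandardBorelSpace β] [Nonempty β] {V : Ω → α} {Y : Ω → β}
    (hV : Measurable V) (hY : Measurable Y) (hind : IndepFun V Y μ) {f : α × β → ℝ}
    (hf : Measurable f) (hint : Integrable (fun ω => f (V ω, Y ω)) μ) :
    μ[fun ω => f (V ω, Y ω) | MeasurableSpace.comap V inferInstance] =ᵐ[μ]
      fun ω => ∫ y, f (V ω, y) ∂(μ.map Y) := by
  have : IsProbabilityMeasure (μ.map Y) := Measure.isProbabilityMeasure_map hY.aemeasurable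
  refine (condExp_prod_ae_eq_integral_condDistrib hV hY.aemeasurable hf.stronglyMeasurable
    hint).trans ?_
  -- Independence makes the joint law a product, that is, a composition-product with a constant
  -- kernel; uniqueness of the conditional distribution does the rest.
  have h1 : condDistrib Y V μ =ᵐ[μ.map V] Kernel.const α (μ.map Y) := by
    refine condDistrib_ae_eq_of_measure_eq_compProd V hY.aemeasurable ?_
    rw [Measure.compProd_const]
    exact hind.map_prod_eq_prod_map_map hV.aemeasurable hY.aemeasurable
  filter_upwards [ae_of_ae_map hV.aemeasurable h1] with ω hω
  rw [hω, Kernel.const_apply]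

/-- Countability of `α` replaces joint measurability of the sections `S a`: the set of pairs is a
countable union of rectangles. The weights take values in such a space. -/
lemma condExp_indicator_of_indepFun [IsProbabilityMeasure μ] {α β : Type*} [MeasurableSpace α]
    [Countable α] [MeasurableSingletonClass α]
    [MeasurableSpace β] [StandardBorelSpace β] [Nonempty β] {V : Ω → α} {Y : Ω → β}
    (hV : Measurable V) (hY : Measurable Y) (hind : IndepFun V Y μ) {S : α → Set β}
    (hS : ∀ a, MeasurableSet (S a)) :
    μ⟦{ω | Y ω ∈ S (V ω)} | MeasurableSpace.comap V inferInstance⟧ =ᵐ[μ]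
      fun ω => μ.real {ω' | Y ω' ∈ S (V ω)} := by
  have hm : MeasurableSet {p : α × β | p.2 ∈ S p.1} := by
    have : {p : α × β | p.2 ∈ S p.1} = ⋃ a, ({a} : Set α) ×ˢ S a := by
      ext ⟨a, b⟩; simp
    rw [this]
    exact MeasurableSet.iUnion fun a => (measurableSet_singleton a).prod (hS a)
  have hf : Measurable ({p : α × β | p.2 ∈ S p.1}.indicator fun _ => (1 : ℝ)) :=
    measurable_const.indicator hm
  have hm' : MeasurableSet {ω | Y ω ∈ S (V ω)} := (hV.prodMk hY) hm
  have h := condExp_prod_of_indepFun hV hY hind hf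
    ((integrable_const (1 : ℝ)).indicator hm')
  refine Filter.EventuallyEq.trans ?_ (h.trans ?_)
  · rfl
  · refine ae_of_all _ fun ω => ?_
    have : (fun y => {p : α × β | p.2 ∈ S p.1}.indicator (fun _ => (1 : ℝ)) (V ω, y))
        = (S (V ω)).indicator 1 := by
      ext y; simp [Set.indicator]
    simp only [this]
    rw [integral_indicator_one (hS _), measureReal_def, measureReal_def,
      Measure.map_apply hY (hS _)]
    rfl

end Tools

/-! ### Central limit theorem for weighted sums. -/

section WeightedCLT

variable {Ω : Type*} [MeasurableSpace Ω] {μ : Measure Ω}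

/-- The factors are exchanged one at a time; the untouched factors have norm at most one. -/
lemma norm_prod_sub_prod_le_sum {ι : Type*} (s : Finset ι) (f g : ι → ℂ) (hf : ∀ i, ‖f i‖ ≤ 1)
    (hg : ∀ i, ‖g i‖ ≤ 1) : ‖∏ i ∈ s, f i - ∏ i ∈ s, g i‖ ≤ ∑ i ∈ s, ‖f i - g i‖ := by
  classical
  induction s using Finset.induction_on with
  | empty => simp
  | insert i s hi ih =>
    rw [Finset.prod_insert hi, Finset.prod_insert hi, Finset.sum_insert hi]
    have h1 : f i * ∏ j ∈ s, f j - g i * ∏ j ∈ s, g j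
        = (f i - g i) * ∏ j ∈ s, f j + g i * (∏ j ∈ s, f j - ∏ j ∈ s, g j) := by ring
    have h2 : ‖∏ j ∈ s, f j‖ ≤ 1 := by
      rw [norm_prod]
      exact Finset.prod_le_one (fun _ _ => norm_nonneg _) fun j _ => hf j
    rw [h1]
    refine (norm_add_le _ _).trans ?_
    rw [norm_mul, norm_mul]
    have h3 := mul_le_mul (hg i) ih (norm_nonneg _) zero_le_one
    have h4 := mul_le_mul_of_nonneg_left h2 (norm_nonneg (f i - g i))
    linarith

/-- Both characteristic functions have the expansion `1 - t²/2 + o(t²)`, so no moment beyond the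
second is needed. -/
lemma charFun_sub_gaussian_isLittleO {P : Measure Ω} [IsProbabilityMeasure P] {ξ : Ω → ℝ}
    (hξ : AEMeasurable ξ P) (h0 : P[ξ] = 0) (h1 : P[ξ ^ 2] = 1) :
    (fun t => charFun (P.map ξ) t - charFun (gaussianReal 0 1) t) =o[𝓝 0] fun t => t ^ 2 := by
  have hA := taylor_charFun_two hξ h0 h1
  have hB := taylor_charFun_two (P := gaussianReal 0 1) (X := id) aemeasurable_id
    (by simp) (by
      have := variance_id_gaussianReal (μ := 0) (v := 1)
      rw [variance_eq_sub (memLp_id_gaussianReal 2)] at this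
      simpa using this)
  rw [Measure.map_id] at hB
  refine (hA.sub hB).congr_left fun t => ?_
  ring

/-- Central limit theorem for weighted sums of i.i.d. random variables with asymptotically
negligible weights. -/
theorem tendstoInDistribution_weighted_sum [IsProbabilityMeasure μ] {ξ : ℕ → Ω → ℝ}
    (hmeas : ∀ i, Measurable (ξ i)) (hindep : iIndepFun ξ μ)
    (hident : ∀ i, IdentDistrib (ξ i) (ξ 0) μ μ) (h0 : μ[ξ 0] = 0) (h1 : μ[ξ 0 ^ 2] = 1)
    {n : ℕ → ℕ} {a : ∀ k, Fin (n k) → ℝ}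
    (hsum : Tendsto (fun k => ∑ i, a k i ^ 2) atTop (𝓝 1))
    (hmax : ∀ ε > 0, ∀ᶠ k in atTop, ∀ i, |a k i| ≤ ε) :
    TendstoInDistribution (fun k ω => ∑ i, a k i * ξ i ω) atTop (id : ℝ → ℝ) (fun _ => μ)
      (gaussianReal 0 1) where
  forall_aemeasurable k := by fun_prop
  aemeasurable_limit := aemeasurable_id
  tendsto := by
    refine ProbabilityMeasure.tendsto_iff_tendsto_charFun.2 fun t => ?_
    simp only [ProbabilityMeasure.coe_mk, Measure.map_id]
    have hprod : ∀ k, charFun (μ.map fun ω => ∑ i, a k i * ξ i ω) t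
        = ∏ i, charFun (μ.map (ξ 0)) (a k i * t) := by
      intro k
      have hi : iIndepFun (fun (i : Fin (n k)) ω => a k i * ξ i ω) μ :=
        (hindep.precomp Fin.val_injective).comp (fun i x => a k i * x) (by fun_prop)
      rw [hi.charFun_map_fun_sum_eq_prod (fun i => by fun_prop), Finset.prod_apply]
      refine Finset.prod_congr rfl fun i _ => ?_
      rw [charFun_map_mul_comp (hmeas _).aemeasurable, (hident i).map_eq]
    -- Independent Gaussian factors multiply exactly to `exp(-(t²/2) ∑ a_i²)`, so only the limit of
    -- `∑ a_i²` enters.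
    have hG : Tendsto (fun k => ∏ i, charFun (gaussianReal 0 1) (a k i * t)) atTop
        (𝓝 (charFun (gaussianReal 0 1) t)) := by
      have h2 : ∀ k, ∏ i, charFun (gaussianReal 0 1) (a k i * t)
          = Complex.exp (((-(t ^ 2 / 2) * ∑ i, a k i ^ 2 : ℝ) : ℂ)) := by
        intro k
        simp only [charFun_gaussianReal]
        rw [← Complex.exp_sum]
        congr 1
        push_cast
        rw [Finset.mul_sum]
        refine Finset.sum_congr rfl fun i _ => ?_
        simp; ring
      simp only [h2]
      have e : charFun (gaussianReal 0 1) t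
          = (Complex.exp ∘ Complex.ofReal) (-(t ^ 2 / 2) * 1) := by
        rw [charFun_gaussianReal]; simp
      rw [e]
      have h3 := (Complex.continuous_exp.comp Complex.continuous_ofReal).continuousAt.tendsto.comp
        (hsum.const_mul (-(t ^ 2 / 2)))
      exact h3
    have hD : Tendsto (fun k => ∏ i, charFun (μ.map (ξ 0)) (a k i * t)
        - ∏ i, charFun (gaussianReal 0 1) (a k i * t)) atTop (𝓝 0) := by
      have hO := charFun_sub_gaussian_isLittleO (hmeas 0).aemeasurable h0 h1
      rw [tendsto_zero_iff_norm_tendsto_zero, Metric.tendsto_nhds]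
      intro ε hε
      -- Eventually `∑ a_i² < 2`, so the summed error is at most `(ε/C) · 2t²`; the `+ 1` keeps `C`
      -- positive and makes the last inequality strict.
      set C := 2 * (t ^ 2 + 1) with hC
      have hCpos : 0 < C := by positivity
      obtain ⟨δ, hδ, hb⟩ := Metric.eventually_nhds_iff.1
        (Asymptotics.isLittleO_iff.1 hO (c := ε / C) (by positivity))
      have := Measure.isProbabilityMeasure_map (μ := μ) (hmeas 0).aemeasurable
      filter_upwards [hmax (δ / (2 * (|t| + 1))) (by positivity),
        hsum.eventually_lt_const (one_lt_two)] with k hk hk2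
      rw [dist_zero_right, norm_norm]
      refine (norm_prod_sub_prod_le_sum _ _ _ (fun _ => norm_charFun_le_one _)
        (fun _ => norm_charFun_le_one _)).trans_lt ?_
      calc ∑ i, ‖charFun (μ.map (ξ 0)) (a k i * t) - charFun (gaussianReal 0 1) (a k i * t)‖
          ≤ ∑ i, ε / C * (a k i ^ 2 * t ^ 2) := by
            refine Finset.sum_le_sum fun i _ => ?_
            have hlt : dist (a k i * t) 0 < δ := by
              rw [dist_zero_right, Real.norm_eq_abs, abs_mul]
              calc |a k i| * |t| ≤ δ / (2 * (|t| + 1)) * |t| := by gcongr; exact hk i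
                _ = δ * (|t| / (2 * (|t| + 1))) := by ring
                _ < δ * 1 := by
                  gcongr
                  rw [div_lt_one (by positivity)]
                  linarith [abs_nonneg t]
                _ = δ := mul_one _
            have := hb hlt
            rwa [Real.norm_eq_abs, abs_of_nonneg (by positivity), mul_pow] at this
        _ = ε / C * (t ^ 2 * ∑ i, a k i ^ 2) := by
            rw [← Finset.mul_sum, ← Finset.sum_mul]; ring
        _ ≤ ε / C * (t ^ 2 * 2) := by gcongr
        _ < ε / C * C := by gcongr; rw [hC]; linarith
        _ = ε := by field_simp
    have := hD.add hG
    rw [zero_add] at this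
    refine this.congr fun k => ?_
    rw [hprod]; ring

end WeightedCLT

/-! ### Moments of the centred multinomial weights, by recursion over the draws. -/

section Multinomial

lemma weight_eq_sum {n m : ℕ} (d : Fin m → Fin n) (i : Fin n) :
    weight d i = ∑ s, if d s = i then 1 else 0 := by
  rw [weight, Fintype.card_subtype, Finset.card_filter]

lemma sum_weight {n m : ℕ} (d : Fin m → Fin n) : ∑ i, weight d i = m := by
  simp only [weight_eq_sum]
  rw [Finset.sum_comm]
  simp

/-- The centred weights `w_i - m / n`. -/
noncomputable def centredWeight {n m : ℕ} (d : Fin m → Fin n) (i : Fin n) : ℝ :=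
  (weight d i : ℝ) - m / n

lemma sum_centredWeight {n m : ℕ} (hn : 1 ≤ n) (d : Fin m → Fin n) :
    ∑ i, centredWeight d i = 0 := by
  have hn' : (n : ℝ) ≠ 0 := by positivity
  simp only [centredWeight, Finset.sum_sub_distrib]
  rw [← Nat.cast_sum, sum_weight]
  simp; field_simp; simp

lemma centredWeight_cons {n m : ℕ} (j : Fin n) (d : Fin m → Fin n) (i : Fin n) :
    centredWeight (Fin.cons j d : Fin (m + 1) → Fin n) i
      = centredWeight d i + ((if j = i then 1 else 0) - 1 / n) := by
  simp only [centredWeight, weight_eq_sum, Fin.sum_univ_succ, Fin.cons_zero, Fin.cons_succ]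
  push_cast
  ring

/-- Expectations over uniform draws are computed as sums over all `n ^ m` draw sequences; splitting
off one draw is the induction step for each moment. -/
lemma sum_draws_succ {n m : ℕ} (f : (Fin (m + 1) → Fin n) → ℝ) :
    ∑ d, f d = ∑ d : Fin m → Fin n, ∑ j, f (Fin.cons j d) := by
  rw [← (Fin.consEquiv fun _ : Fin (m + 1) => Fin n).sum_comp, Fintype.sum_prod_type,
    Finset.sum_comm]
  rfl

/-- The increment is a unit vector minus the constant `1/n`. It has squared length `1 - 1/n`, and
its constant part is orthogonal to the centred weights, which leaves the cross term `2 c_j`. -/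
lemma sum_sq_centredWeight_cons {n m : ℕ} (hn : 1 ≤ n) (j : Fin n) (d : Fin m → Fin n) :
    ∑ i, centredWeight (Fin.cons j d : Fin (m + 1) → Fin n) i ^ 2
      = ∑ i, centredWeight d i ^ 2 + 2 * centredWeight d j + (1 - 1 / n) := by
  have hn' : (n : ℝ) ≠ 0 := by positivity
  have h : ∀ i, centredWeight (Fin.cons j d : Fin (m + 1) → Fin n) i ^ 2
      = centredWeight d i ^ 2 - 2 / n * centredWeight d i + 1 / n ^ 2
        + if j = i then 2 * centredWeight d i + (1 - 2 / n) else 0 := by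
    intro i
    rw [centredWeight_cons]
    split_ifs <;> ring
  simp only [h, Finset.sum_add_distrib, Finset.sum_sub_distrib, ← Finset.mul_sum,
    sum_centredWeight hn, Finset.sum_ite_eq, Finset.mem_univ, if_true, Finset.sum_const,
    Finset.card_univ, Fintype.card_fin, nsmul_eq_mul]
  field_simp
  ring

/-- The compensated sum of squares is a martingale in `m`: its increment `2 c_j` averages to zero
over `j`. -/
lemma sum_draws_sum_sq {n : ℕ} (hn : 1 ≤ n) (m : ℕ) :
    ∑ d : Fin m → Fin n, (∑ i, centredWeight d i ^ 2 - m * (1 - 1 / n)) = 0 := by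
  induction m with
  | zero => simp [centredWeight, weight_eq_sum]
  | succ m ih =>
    rw [sum_draws_succ, Finset.sum_comm]
    have h : ∀ (j : Fin n) (d : Fin m → Fin n),
        ∑ i, centredWeight (Fin.cons j d : Fin (m + 1) → Fin n) i ^ 2
          - ((m + 1 : ℕ) : ℝ) * (1 - 1 / n)
        = (∑ i, centredWeight d i ^ 2 - m * (1 - 1 / n)) + 2 * centredWeight d j := by
      intro j d
      rw [sum_sq_centredWeight_cons hn]; push_cast; ring
    simp only [h, Finset.sum_add_distrib, ih, zero_add]
    rw [Finset.sum_comm]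
    simp only [← Finset.mul_sum, sum_centredWeight hn]
    simp

lemma sum_draws_sum_sq' {n : ℕ} (hn : 1 ≤ n) (m : ℕ) :
    ∑ d : Fin m → Fin n, ∑ i, centredWeight d i ^ 2 = (n : ℝ) ^ m * (m * (1 - 1 / (n : ℝ))) := by
  have h := sum_draws_sum_sq hn m
  rw [Finset.sum_sub_distrib, sub_eq_zero] at h
  rw [h]
  simp

/-- Martingale increments are orthogonal, so the second moment grows in one step by `4/n` times the
mean of `∑ c_i²`, hence by at most `4m/n`. These increments add up to less than `2m²/n`. -/
lemma sum_draws_sq_sum_sq_le {n : ℕ} (hn : 1 ≤ n) (m : ℕ) :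
    ∑ d : Fin m → Fin n, (∑ i, centredWeight d i ^ 2 - m * (1 - 1 / n)) ^ 2
      ≤ (n : ℝ) ^ m * (2 * (m : ℝ) ^ 2 / (n : ℝ)) := by
  have hn' : (0 : ℝ) < n := by positivity
  induction m with
  | zero => simp [centredWeight, weight_eq_sum]
  | succ m ih =>
    rw [sum_draws_succ]
    have h : ∀ d : Fin m → Fin n,
        ∑ j, (∑ i, centredWeight (Fin.cons j d : Fin (m + 1) → Fin n) i ^ 2
          - ((m + 1 : ℕ) : ℝ) * (1 - 1 / n)) ^ 2
        = n * (∑ i, centredWeight d i ^ 2 - m * (1 - 1 / n)) ^ 2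
          + 4 * ∑ i, centredWeight d i ^ 2 := by
      intro d
      set T := ∑ i, centredWeight d i ^ 2 - m * (1 - 1 / (n : ℝ)) with hT
      have h' : ∀ j, (∑ i, centredWeight (Fin.cons j d : Fin (m + 1) → Fin n) i ^ 2
          - ((m + 1 : ℕ) : ℝ) * (1 - 1 / n)) ^ 2
          = T ^ 2 + 4 * T * centredWeight d j + 4 * centredWeight d j ^ 2 := by
        intro j
        rw [sum_sq_centredWeight_cons hn, hT]; push_cast; ring
      simp only [h', Finset.sum_add_distrib, ← Finset.mul_sum, sum_centredWeight hn]
      simp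
    simp only [h, Finset.sum_add_distrib, ← Finset.mul_sum, sum_draws_sum_sq' hn]
    have h1 : (n : ℝ) * ∑ d : Fin m → Fin n,
        (∑ i, centredWeight d i ^ 2 - m * (1 - 1 / (n : ℝ))) ^ 2 ≤ n * (n ^ m * (2 * m ^ 2 / n)) := by
      gcongr
    have h2 : (n : ℝ) ^ m * (m * (1 - 1 / n)) ≤ n ^ m * m := by
      gcongr
      have : (0 : ℝ) ≤ 1 / n := by positivity
      nlinarith [(Nat.cast_nonneg m : (0 : ℝ) ≤ m)]
    have h3 : (n : ℝ) ^ (m + 1) * (2 * ((m + 1 : ℕ) : ℝ) ^ 2 / n)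
        = n * (n ^ m * (2 * m ^ 2 / n)) + 4 * (n ^ m * m) + 2 * n ^ m := by
      push_cast; field_simp; ring
    have h4 : (0 : ℝ) ≤ n ^ m := by positivity
    rw [h3]
    linarith

lemma sum_sum_fourth_centredWeight_cons_le {n m : ℕ} (hn : 1 ≤ n) (d : Fin m → Fin n) :
    ∑ j, ∑ i, centredWeight (Fin.cons j d : Fin (m + 1) → Fin n) i ^ 4
      ≤ n * ∑ i, centredWeight d i ^ 4 + 6 * ∑ i, centredWeight d i ^ 2 + n := by
  have hn' : (0 : ℝ) < n := by positivity
  set u : ℝ := 1 / n with hu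
  have hnu : (n : ℝ) * u = 1 := by rw [hu]; field_simp
  have hu0 : 0 ≤ u := by positivity
  have hu1 : u ≤ 1 := by rw [hu, div_le_one hn']; exact_mod_cast hn
  -- Four times the sum over `j` of the cubed increments; its value is irrelevant, because the term
  -- `κ c_i` disappears on summing over `i`.
  set κ : ℝ := 4 * ((1 - u) ^ 3 - (n - 1) * u ^ 3) with hκ
  have h : ∀ i, ∑ j, centredWeight (Fin.cons j d : Fin (m + 1) → Fin n) i ^ 4
      ≤ n * centredWeight d i ^ 4 + 6 * centredWeight d i ^ 2 + κ * centredWeight d i + 1 := by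
    intro i
    set c := centredWeight d i
    have h' : ∀ j, centredWeight (Fin.cons j d : Fin (m + 1) → Fin n) i ^ 4
        = (c - u) ^ 4 + if j = i then (c + 1 - u) ^ 4 - (c - u) ^ 4 else 0 := by
      intro j
      rw [centredWeight_cons]
      split_ifs <;> ring
    simp only [h', Finset.sum_add_distrib, Finset.sum_ite_eq', Finset.mem_univ, if_true,
      Finset.sum_const, Finset.card_univ, Fintype.card_fin, nsmul_eq_mul]
    -- The last summand collects everything that vanishes because `n * u = 1`, in particular the
    -- cubic term in `c`.
    have e : (n : ℝ) * (c - u) ^ 4 + ((c + 1 - u) ^ 4 - (c - u) ^ 4)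
        = n * c ^ 4 + 6 * c ^ 2 * (1 - u) + κ * c + (u ^ 3 * (n * u) - u ^ 4 + (1 - u) ^ 4)
          + (n * u - 1) * (6 * c ^ 2 * u - 4 * c ^ 3) := by
      rw [hκ]; ring
    rw [e, hnu]
    have h1 : 6 * c ^ 2 * (1 - u) ≤ 6 * c ^ 2 := by nlinarith [sq_nonneg c]
    have h2 : u ^ 3 * 1 - u ^ 4 + (1 - u) ^ 4 ≤ 1 := by
      have e3 : u ^ 3 ≤ u := pow_le_of_le_one hu0 hu1 (by norm_num)
      have e4 : (1 - u) ^ 4 ≤ 1 - u := pow_le_of_le_one (by linarith) (by linarith) (by norm_num)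
      have e5 : 0 ≤ u ^ 4 := by positivity
      linarith
    linarith
  rw [Finset.sum_comm]
  refine (Finset.sum_le_sum fun i _ => h i).trans ?_
  simp only [Finset.sum_add_distrib, ← Finset.mul_sum, sum_centredWeight hn]
  simp

/-- On average one more draw adds at most `6m/n + 1`, and these increments sum to at most `3m²/n +
m`. -/
lemma sum_draws_sum_fourth_le {n : ℕ} (hn : 1 ≤ n) (m : ℕ) :
    ∑ d : Fin m → Fin n, ∑ i, centredWeight d i ^ 4 ≤ n ^ m * (3 * m ^ 2 / n + m) := by
  have hn' : (0 : ℝ) < n := by positivity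
  induction m with
  | zero => simp [centredWeight, weight_eq_sum]
  | succ m ih =>
    rw [sum_draws_succ]
    refine (Finset.sum_le_sum fun d _ => sum_sum_fourth_centredWeight_cons_le hn d).trans ?_
    simp only [Finset.sum_add_distrib, ← Finset.mul_sum, sum_draws_sum_sq' hn]
    have h1 : (n : ℝ) * ∑ d : Fin m → Fin n, ∑ i, centredWeight d i ^ 4
        ≤ n * (n ^ m * (3 * m ^ 2 / n + m)) := by gcongr
    have h2 : (n : ℝ) ^ m * (m * (1 - 1 / n)) ≤ n ^ m * m := by
      gcongr
      have : (0 : ℝ) ≤ 1 / n := by positivity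
      nlinarith [(Nat.cast_nonneg m : (0 : ℝ) ≤ m)]
    have h3 : (n : ℝ) ^ (m + 1) * (3 * ((m + 1 : ℕ) : ℝ) ^ 2 / n + ((m + 1 : ℕ) : ℝ))
        = n * (n ^ m * (3 * m ^ 2 / n + m)) + 6 * (n ^ m * m) + 3 * n ^ m + n ^ m * n := by
      push_cast; field_simp; ring
    have h4 : (0 : ℝ) ≤ n ^ m := by positivity
    have h5 : ∑ _d : Fin m → Fin n, (n : ℝ) = n ^ m * n := by simp
    rw [h3, h5]
    linarith

/-- A measure of how far the standardized weights `c_i = (w_i - m / n) / √m` are from satisfying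
`∑ c_i² = 1` and `∑ c_i⁴ = 0`. -/
noncomputable def weightDefect {n m : ℕ} (d : Fin m → Fin n) : ℝ :=
  ((∑ i, centredWeight d i ^ 2) / m - 1) ^ 2 + (∑ i, centredWeight d i ^ 4) / m ^ 2

lemma weightDefect_nonneg {n m : ℕ} (d : Fin m → Fin n) : 0 ≤ weightDefect d := by
  unfold weightDefect; positivity

/-- In `9/n`, the fluctuation of `∑ c_i²` contributes `4`, its bias `-1/n` contributes `2`, and the
fourth moment contributes `3` together with the separate `1/m`. -/
lemma sum_draws_weightDefect_le {n m : ℕ} (hn : 1 ≤ n) (hm : 1 ≤ m) :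
    ∑ d : Fin m → Fin n, weightDefect d ≤ n ^ m * (9 / n + 1 / m) := by
  have hn' : (0 : ℝ) < n := by positivity
  have hm' : (0 : ℝ) < m := by positivity
  have h : ∀ d : Fin m → Fin n, weightDefect d
      ≤ 2 / m ^ 2 * (∑ i, centredWeight d i ^ 2 - m * (1 - 1 / n)) ^ 2 + 2 / n ^ 2
        + 1 / m ^ 2 * ∑ i, centredWeight d i ^ 4 := by
    intro d
    have e : (∑ i, centredWeight d i ^ 2) / m - 1
        = (∑ i, centredWeight d i ^ 2 - m * (1 - 1 / n)) / m + (-1 / n) := by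
      field_simp; ring
    unfold weightDefect
    rw [e]
    have := add_sq_le (a := (∑ i, centredWeight d i ^ 2 - m * (1 - 1 / (n : ℝ))) / m)
      (b := (-1 / n : ℝ))
    have e2 : 2 / (m : ℝ) ^ 2 * (∑ i, centredWeight d i ^ 2 - m * (1 - 1 / (n : ℝ))) ^ 2 + 2 / n ^ 2
        = 2 * (((∑ i, centredWeight d i ^ 2 - m * (1 - 1 / (n : ℝ))) / m) ^ 2 + (-1 / n : ℝ) ^ 2) := by
      field_simp
    rw [e2, one_div_mul_eq_div]
    linarith
  refine (Finset.sum_le_sum fun d _ => h d).trans ?_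
  simp only [Finset.sum_add_distrib, ← Finset.mul_sum]
  have h1 : 2 / (m : ℝ) ^ 2 * ∑ d : Fin m → Fin n,
      (∑ i, centredWeight d i ^ 2 - m * (1 - 1 / (n : ℝ))) ^ 2
      ≤ 2 / m ^ 2 * (n ^ m * (2 * m ^ 2 / n)) := by
    gcongr; exact sum_draws_sq_sum_sq_le hn m
  have h2 : 1 / (m : ℝ) ^ 2 * ∑ d : Fin m → Fin n, ∑ i, centredWeight d i ^ 4
      ≤ 1 / m ^ 2 * (n ^ m * (3 * m ^ 2 / n + m)) := by
    gcongr; exact sum_draws_sum_fourth_le hn m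
  have h3 : ∑ _d : Fin m → Fin n, (2 / (n : ℝ) ^ 2) ≤ (n : ℝ) ^ m * (2 / (n : ℝ)) := by
    simp only [Finset.sum_const, Finset.card_univ, Fintype.card_fun, Fintype.card_fin,
      nsmul_eq_mul, Nat.cast_pow]
    have hn1 : (1 : ℝ) ≤ n := by exact_mod_cast hn
    gcongr
    nlinarith
  have h4 : (n : ℝ) ^ m * (9 / n + 1 / m) = 2 / m ^ 2 * (n ^ m * (2 * m ^ 2 / n)) + n ^ m * (2 / n)
      + 1 / m ^ 2 * (n ^ m * (3 * m ^ 2 / n + m)) := by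
    field_simp; ring
  rw [h4]
  linarith

end Multinomial

/-! ### Hoeffding decomposition of the kernel. -/

section Projection

/-- The mean `E h (X, Y)` of a kernel for independent `X, Y` of law `ν`. -/
noncomputable def kernelMean (h : ℝ → ℝ → ℝ) (ν : Measure ℝ) : ℝ :=
  ∫ p, h p.1 p.2 ∂(ν.prod ν)

/-- The centred projection `x ↦ E h (x, Y) - E h (X, Y)` of a kernel. -/
noncomputable def kernelProj (h : ℝ → ℝ → ℝ) (ν : Measure ℝ) (x : ℝ) : ℝ :=
  ∫ y, h x y ∂ν - kernelMean h ν

/-- The completely degenerate part of a kernel in its Hoeffding decomposition. -/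
noncomputable def kernelDeg (h : ℝ → ℝ → ℝ) (ν : Measure ℝ) (x y : ℝ) : ℝ :=
  h x y - kernelMean h ν - kernelProj h ν x - kernelProj h ν y

variable {h : ℝ → ℝ → ℝ} {ν : Measure ℝ}

lemma kernelDeg_symm (hs : ∀ x y, h x y = h y x) (x y : ℝ) :
    kernelDeg h ν x y = kernelDeg h ν y x := by
  rw [kernelDeg, kernelDeg, hs x y]; ring

variable [IsProbabilityMeasure ν]

lemma sq_integral_le {α : Type*} [MeasurableSpace α] {P : Measure α} [IsProbabilityMeasure P]
    {f : α → ℝ} (hf : MemLp f 2 P) : (∫ x, f x ∂P) ^ 2 ≤ ∫ x, f x ^ 2 ∂P := by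
  have := variance_nonneg f P
  rw [variance_eq_sub hf] at this
  simpa using this

lemma measurable_kernelProj (hm : Measurable (Function.uncurry h)) :
    Measurable (kernelProj h ν) :=
  (hm.stronglyMeasurable.integral_prod_right (ν := ν)).measurable.sub_const _

lemma measurable_kernelDeg (hm : Measurable (Function.uncurry h)) :
    Measurable (Function.uncurry (kernelDeg h ν)) :=
  ((hm.sub_const _).sub ((measurable_kernelProj hm).comp measurable_fst)).sub
    ((measurable_kernelProj hm).comp measurable_snd)

/-- Jensen's inequality on almost every slice `h x ·`, followed by Fubini. -/
lemma memLp_kernelProj (hm : Measurable (Function.uncurry h))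
    (h2 : MemLp (Function.uncurry h) 2 (ν.prod ν)) : MemLp (kernelProj h ν) 2 ν := by
  have hsq := h2.integrable_sq
  have hmi := hm.stronglyMeasurable.integral_prod_right (ν := ν)
  have hI : MemLp (fun x => ∫ y, h x y ∂ν) 2 ν := by
    rw [memLp_two_iff_integrable_sq hmi.aestronglyMeasurable]
    refine hsq.integral_prod_left.mono' (hmi.measurable.pow_const 2).aestronglyMeasurable ?_
    filter_upwards [hsq.prod_right_ae] with x hx
    have hx2 : MemLp (fun y => h x y) 2 ν :=
      (memLp_two_iff_integrable_sq (hm.comp measurable_prodMk_left).aestronglyMeasurable).2 hx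
    rw [Real.norm_eq_abs, abs_of_nonneg (sq_nonneg _)]
    exact sq_integral_le hx2
  exact hI.sub (memLp_const _)

lemma integral_kernelProj (h2 : MemLp (Function.uncurry h) 2 (ν.prod ν)) :
    ∫ x, kernelProj h ν x ∂ν = 0 := by
  have hi : Integrable (Function.uncurry h) (ν.prod ν) := h2.integrable (by norm_num)
  have h1 : Integrable (fun x => ∫ y, h x y ∂ν) ν := hi.integral_prod_left
  have h3 : kernelMean h ν = ∫ x, ∫ y, h x y ∂ν ∂ν := integral_prod _ hi
  simp only [kernelProj]
  rw [integral_sub h1 (integrable_const _), h3]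
  simp

lemma memLp_kernelDeg (hm : Measurable (Function.uncurry h))
    (h2 : MemLp (Function.uncurry h) 2 (ν.prod ν)) :
    MemLp (Function.uncurry (kernelDeg h ν)) 2 (ν.prod ν) := by
  have hg := memLp_kernelProj hm h2
  exact ((h2.sub (memLp_const _)).sub (hg.comp_measurePreserving measurePreserving_fst)).sub
    (hg.comp_measurePreserving measurePreserving_snd)

/-- Complete degeneracy, the source of all orthogonality below. It is claimed only for almost every
`x`, where the slice `h x ·` is integrable. -/
lemma integral_kernelDeg_right (hm : Measurable (Function.uncurry h))
    (h2 : MemLp (Function.uncurry h) 2 (ν.prod ν)) : ∀ᵐ x ∂ν, ∫ y, kernelDeg h ν x y ∂ν = 0 := by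
  have hi : Integrable (Function.uncurry h) (ν.prod ν) := h2.integrable (by norm_num)
  have hg : Integrable (kernelProj h ν) ν := (memLp_kernelProj hm h2).integrable (by norm_num)
  filter_upwards [hi.prod_right_ae] with x hx
  have hx' : Integrable (fun y => h x y) ν := hx
  simp only [kernelDeg]
  have e1 : ∫ y, (h x y - kernelMean h ν - kernelProj h ν x - kernelProj h ν y) ∂ν
      = ∫ y, (h x y - (kernelMean h ν + kernelProj h ν x)) ∂ν - ∫ y, kernelProj h ν y ∂ν := by
    have hs : Integrable (fun y => h x y - (kernelMean h ν + kernelProj h ν x)) ν :=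
      hx'.sub (integrable_const _)
    rw [← integral_sub hs hg]
    congr 1; ext y; ring
  rw [e1, integral_sub hx' (integrable_const _), integral_kernelProj h2]
  simp [kernelProj]

end Projection

/-! ### Orthogonality of the degenerate parts of an i.i.d. sample. -/

/-- A measurable symmetric kernel `h` and an i.i.d. sequence `X` with `E h (X₀, X₁)² < ∞`. -/
structure IIDKernel {Ω : Type*} [MeasurableSpace Ω] (μ : Measure Ω) (h : ℝ → ℝ → ℝ)
    (X : ℕ → Ω → ℝ) : Prop where
  meas : Measurable (Function.uncurry h)
  symm : ∀ x y, h x y = h y x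
  meas_X : ∀ i, Measurable (X i)
  indep : iIndepFun X μ
  ident : ∀ i, IdentDistrib (X i) (X 0) μ μ
  integrable_kernel_sq : Integrable (fun ω => h (X 0 ω) (X 1 ω) ^ 2) μ

namespace IIDKernel

variable {Ω : Type*} [MeasurableSpace Ω] {μ : Measure Ω}
  {h : ℝ → ℝ → ℝ} {X : ℕ → Ω → ℝ}

lemma measurePreserving (H : IIDKernel μ h X) (i : ℕ) :
    MeasurePreserving (X i) μ (μ.map (X 0)) :=
  ⟨H.meas_X i, (H.ident i).map_eq⟩

/-- The second moment of the degenerate part. -/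
noncomputable def degSq (_ : IIDKernel μ h X) : ℝ :=
  ∫ p, kernelDeg h (μ.map (X 0)) p.1 p.2 ^ 2 ∂((μ.map (X 0)).prod (μ.map (X 0)))

lemma degSq_nonneg (H : IIDKernel μ h X) : 0 ≤ H.degSq :=
  integral_nonneg fun _ => sq_nonneg _

/-- The projection of the kernel with respect to the law of the observations. -/
noncomputable abbrev g (_ : IIDKernel μ h X) : ℝ → ℝ := kernelProj h (μ.map (X 0))

/-- The degenerate part of the kernel with respect to the law of the observations. -/
noncomputable abbrev deg (_ : IIDKernel μ h X) : ℝ → ℝ → ℝ := kernelDeg h (μ.map (X 0))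

lemma deg_symm (H : IIDKernel μ h X) (x y : ℝ) : H.deg x y = H.deg y x :=
  kernelDeg_symm H.symm x y

variable [IsProbabilityMeasure μ]

lemma isProbabilityMeasure_law (H : IIDKernel μ h X) : IsProbabilityMeasure (μ.map (X 0)) :=
  Measure.isProbabilityMeasure_map (H.meas_X 0).aemeasurable

lemma measurePreserving_pair (H : IIDKernel μ h X) {i j : ℕ} (hij : i ≠ j) :
    MeasurePreserving (fun ω => (X i ω, X j ω)) μ ((μ.map (X 0)).prod (μ.map (X 0))) := by
  refine ⟨(H.meas_X i).prodMk (H.meas_X j), ?_⟩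
  rw [(H.indep.indepFun hij).map_prod_eq_prod_map_map (H.meas_X i).aemeasurable
    (H.meas_X j).aemeasurable, (H.ident i).map_eq, (H.ident j).map_eq]

lemma memLp_kernel (H : IIDKernel μ h X) :
    MemLp (Function.uncurry h) 2 ((μ.map (X 0)).prod (μ.map (X 0))) := by
  have hp := H.measurePreserving_pair zero_ne_one
  rw [← hp.map_eq, memLp_map_measure_iff H.meas.aestronglyMeasurable hp.aemeasurable]
  exact (memLp_two_iff_integrable_sq (H.meas.comp hp.measurable).aestronglyMeasurable).2 H.integrable_kernel_sq

lemma measurable_g (H : IIDKernel μ h X) : Measurable H.g := by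
  have := H.isProbabilityMeasure_law
  exact measurable_kernelProj H.meas

lemma measurable_deg (H : IIDKernel μ h X) : Measurable (Function.uncurry H.deg) := by
  have := H.isProbabilityMeasure_law
  exact measurable_kernelDeg H.meas

lemma memLp_g (H : IIDKernel μ h X) (i : ℕ) : MemLp (fun ω => H.g (X i ω)) 2 μ := by
  have := H.isProbabilityMeasure_law
  exact (memLp_kernelProj H.meas H.memLp_kernel).comp_measurePreserving (H.measurePreserving i)

lemma integral_g (H : IIDKernel μ h X) (i : ℕ) : ∫ ω, H.g (X i ω) ∂μ = 0 := by
  have := H.isProbabilityMeasure_law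
  rw [← integral_kernelProj H.memLp_kernel]
  conv_rhs => rw [← (H.measurePreserving i).map_eq]
  rw [integral_map (H.meas_X i).aemeasurable, (H.measurePreserving i).map_eq]
  rw [(H.measurePreserving i).map_eq]
  exact H.measurable_g.aestronglyMeasurable

lemma memLp_deg (H : IIDKernel μ h X) {i j : ℕ} (hij : i ≠ j) :
    MemLp (fun ω => H.deg (X i ω) (X j ω)) 2 μ := by
  have := H.isProbabilityMeasure_law
  exact (memLp_kernelDeg H.meas H.memLp_kernel).comp_measurePreserving
    (H.measurePreserving_pair hij)

lemma integral_deg_sq (H : IIDKernel μ h X) {i j : ℕ} (hij : i ≠ j) :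
    ∫ ω, H.deg (X i ω) (X j ω) ^ 2 ∂μ = H.degSq := by
  have hp := H.measurePreserving_pair hij
  have h1 : Measurable fun p : ℝ × ℝ => kernelDeg h (μ.map (X 0)) p.1 p.2 ^ 2 :=
    H.measurable_deg.pow_const 2
  rw [degSq]
  conv_rhs => rw [← hp.map_eq]
  rw [integral_map hp.aemeasurable h1.aestronglyMeasurable]

lemma integrable_deg_mul_deg (H : IIDKernel μ h X) {i j p q : ℕ} (hij : i ≠ j) (hpq : p ≠ q) :
    Integrable (fun ω => H.deg (X i ω) (X j ω) * H.deg (X p ω) (X q ω)) μ :=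
  (H.memLp_deg hij).integrable_mul (H.memLp_deg hpq)

/-- `X_j` occurs in one factor only and is independent of the other three variables, so integrating
it out first gives zero by degeneracy. -/
lemma integral_deg_mul_deg_of_ne (H : IIDKernel μ h X) {i j p q : ℕ} (hij : i ≠ j) (hpq : p ≠ q)
    (hjp : j ≠ p) (hjq : j ≠ q) :
    ∫ ω, H.deg (X i ω) (X j ω) * H.deg (X p ω) (X q ω) ∂μ = 0 := by
  have := H.isProbabilityMeasure_law
  -- The index `i` may coincide with `p` or `q`; only the independence of this triple from `X_j` and
  -- the law of its first coordinate are used.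
  set Y : Ω → ℝ × ℝ × ℝ := fun ω => (X i ω, X p ω, X q ω) with hY
  have hYm : Measurable Y := (H.meas_X i).prodMk ((H.meas_X p).prodMk (H.meas_X q))
  have hind : IndepFun Y (X j) μ := by
    have h0 := H.indep.indepFun_finset {i, p, q} {j} (by simp [hij.symm, hjp, hjq]) H.meas_X
    exact h0.comp
      (φ := fun f : ({i, p, q} : Finset ℕ) → ℝ =>
        (f ⟨i, by simp⟩, f ⟨p, by simp⟩, f ⟨q, by simp⟩))
      (ψ := fun f : ({j} : Finset ℕ) → ℝ => f ⟨j, by simp⟩) (by fun_prop) (by fun_prop)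
  have hlaw : μ.map (fun ω => (Y ω, X j ω)) = (μ.map Y).prod (μ.map (X 0)) := by
    rw [hind.map_prod_eq_prod_map_map hYm.aemeasurable (H.meas_X j).aemeasurable,
      (H.ident j).map_eq]
  have hYp := Measure.isProbabilityMeasure_map (μ := μ) hYm.aemeasurable
  set F : (ℝ × ℝ × ℝ) × ℝ → ℝ := fun z => H.deg z.1.1 z.2 * H.deg z.1.2.1 z.1.2.2 with hF
  have hFm : Measurable F :=
    (H.measurable_deg.comp (measurable_fst.fst.prodMk measurable_snd)).mul
      (H.measurable_deg.comp measurable_fst.snd)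
  have hm2 : AEMeasurable (fun ω => (Y ω, X j ω)) μ := (hYm.prodMk (H.meas_X j)).aemeasurable
  have hFi : Integrable F ((μ.map Y).prod (μ.map (X 0))) := by
    rw [← hlaw, integrable_map_measure hFm.aestronglyMeasurable hm2]
    exact H.integrable_deg_mul_deg hij hpq
  have e : ∫ ω, H.deg (X i ω) (X j ω) * H.deg (X p ω) (X q ω) ∂μ
      = ∫ z, F z ∂((μ.map Y).prod (μ.map (X 0))) := by
    rw [← hlaw, integral_map hm2 hFm.aestronglyMeasurable]
  rw [e, integral_prod _ hFi]
  have hz : ∀ᵐ y ∂(μ.map Y), ∫ x, F (y, x) ∂(μ.map (X 0)) = 0 := by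
    have h1 := integral_kernelDeg_right H.meas H.memLp_kernel
    have h2 : (μ.map Y).map Prod.fst = μ.map (X 0) := by
      rw [Measure.map_map measurable_fst hYm]
      exact (H.ident i).map_eq
    rw [← h2] at h1
    filter_upwards [ae_of_ae_map measurable_fst.aemeasurable h1] with y hy
    rw [h2] at hy
    simp only [hF]
    rw [integral_mul_const, hy, zero_mul]
  rw [integral_congr_ae hz]
  simp

/-- Two different unordered pairs share at most one index, so `i` or `j` is free; symmetry moves the
free one into the second slot. -/
lemma integral_deg_mul_deg_eq_zero (H : IIDKernel μ h X) {i j p q : ℕ} (hij : i ≠ j) (hpq : p ≠ q)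
    (h1 : (p, q) ≠ (i, j)) (h2 : (p, q) ≠ (j, i)) :
    ∫ ω, H.deg (X i ω) (X j ω) * H.deg (X p ω) (X q ω) ∂μ = 0 := by
  by_cases hj : j ≠ p ∧ j ≠ q
  · exact H.integral_deg_mul_deg_of_ne hij hpq hj.1 hj.2
  · have hi : i ≠ p ∧ i ≠ q := by
      simp only [ne_eq, Prod.mk.injEq] at *
      omega
    have := H.integral_deg_mul_deg_of_ne hij.symm hpq hi.1 hi.2
    simpa only [H.deg_symm (X j _) (X i _)] using this

/-- The pairs of distinct indices. -/
def offDiagPairs (n : ℕ) : Finset (Fin n × Fin n) := Finset.univ.filter fun p => p.1 ≠ p.2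

lemma mem_offDiagPairs {n : ℕ} {p : Fin n × Fin n} : p ∈ offDiagPairs n ↔ p.1 ≠ p.2 := by
  simp [offDiagPairs]

lemma memLp_sum_deg (H : IIDKernel μ h X) {n : ℕ} (c : Fin n × Fin n → ℝ) :
    MemLp (fun ω => ∑ p ∈ offDiagPairs n, c p * H.deg (X p.1 ω) (X p.2 ω)) 2 μ := by
  refine memLp_finsetSum _ fun p hp => ?_
  have hp' : (p.1 : ℕ) ≠ p.2 := fun hc => mem_offDiagPairs.1 hp (Fin.ext hc)
  exact (H.memLp_deg hp').const_mul _

/-- The second moment of a linear combination of the degenerate parts. -/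
lemma integral_sum_deg_sq_le (H : IIDKernel μ h X) {n : ℕ} (c : Fin n × Fin n → ℝ) :
    ∫ ω, (∑ p ∈ offDiagPairs n, c p * H.deg (X p.1 ω) (X p.2 ω)) ^ 2 ∂μ
      ≤ 2 * H.degSq * ∑ p ∈ offDiagPairs n, c p ^ 2 := by
  have hne : ∀ p ∈ offDiagPairs n, (p.1 : ℕ) ≠ p.2 := fun p hp hc =>
    mem_offDiagPairs.1 hp (Fin.ext hc)
  have hint : ∀ p ∈ offDiagPairs n, ∀ q ∈ offDiagPairs n, Integrable (fun ω =>
      c p * H.deg (X p.1 ω) (X p.2 ω) * (c q * H.deg (X q.1 ω) (X q.2 ω))) μ := by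
    intro p hp q hq
    have := (H.integrable_deg_mul_deg (hne p hp) (hne q hq)).const_mul (c p * c q)
    refine this.congr (ae_of_all _ fun ω => ?_)
    simp only []
    ring
  have e1 : ∫ ω, (∑ p ∈ offDiagPairs n, c p * H.deg (X p.1 ω) (X p.2 ω)) ^ 2 ∂μ
      = ∑ p ∈ offDiagPairs n, ∑ q ∈ offDiagPairs n,
        ∫ ω, c p * H.deg (X p.1 ω) (X p.2 ω) * (c q * H.deg (X q.1 ω) (X q.2 ω)) ∂μ := by
    simp only [pow_two, Finset.sum_mul_sum]
    rw [integral_finsetSum _ fun p hp => integrable_finsetSum _ fun q hq => hint p hp q hq]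
    exact Finset.sum_congr rfl fun p hp => integral_finsetSum _ fun q hq => hint p hp q hq
  have hK := H.degSq_nonneg
  -- The Gram matrix lives on `q = p` and `q = p.swap`. The coefficients need not be symmetric, so
  -- `c p * c p.swap` is bounded by the mean of the squares.
  have hb : ∀ p ∈ offDiagPairs n, ∀ q ∈ offDiagPairs n,
      ∫ ω, c p * H.deg (X p.1 ω) (X p.2 ω) * (c q * H.deg (X q.1 ω) (X q.2 ω)) ∂μ
      ≤ (if q = p then c p ^ 2 * H.degSq else 0)
        + (if q = p.swap then (c p ^ 2 + c p.swap ^ 2) / 2 * H.degSq else 0) := by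
    intro p hp q hq
    have e : ∫ ω, c p * H.deg (X p.1 ω) (X p.2 ω) * (c q * H.deg (X q.1 ω) (X q.2 ω)) ∂μ
        = c p * c q * ∫ ω, H.deg (X p.1 ω) (X p.2 ω) * H.deg (X q.1 ω) (X q.2 ω) ∂μ := by
      rw [← integral_const_mul]
      congr 1; ext ω; ring
    rw [e]
    have hsw : p ≠ p.swap := fun hc => mem_offDiagPairs.1 hp (by
      have := congrArg Prod.fst hc; simpa using this)
    by_cases h1 : q = p
    · subst h1
      rw [if_pos rfl, if_neg hsw, add_zero, ← H.integral_deg_sq (hne q hq)]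
      simp only [← pow_two]
      exact le_rfl
    · by_cases h2 : q = p.swap
      · subst h2
        rw [if_neg h1, if_pos rfl, zero_add]
        simp only [Prod.fst_swap, Prod.snd_swap, H.deg_symm (X p.2 _) (X p.1 _), ← pow_two]
        rw [H.integral_deg_sq (hne p hp)]
        have := two_mul_le_add_sq (c p) (c p.swap)
        gcongr
        linarith
      · rw [if_neg h1, if_neg h2, H.integral_deg_mul_deg_eq_zero (hne p hp) (hne q hq)]
        · simp
        · intro hc
          simp only [Prod.mk.injEq] at hc
          exact h1 (Prod.ext (Fin.ext hc.1) (Fin.ext hc.2))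
        · intro hc
          simp only [Prod.mk.injEq] at hc
          exact h2 (Prod.ext (Fin.ext hc.1) (Fin.ext hc.2))
  have hswap : ∑ p ∈ offDiagPairs n, c p.swap ^ 2 = ∑ p ∈ offDiagPairs n, c p ^ 2 :=
    Finset.sum_equiv (Equiv.prodComm _ _)
      (fun p => by simp only [mem_offDiagPairs, Equiv.prodComm_apply, Prod.fst_swap,
        Prod.snd_swap]; exact ne_comm) (fun p _ => rfl)
  rw [e1]
  calc _ ≤ ∑ p ∈ offDiagPairs n, (c p ^ 2 * H.degSq + (c p ^ 2 + c p.swap ^ 2) / 2 * H.degSq) := by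
        refine Finset.sum_le_sum fun p hp => ?_
        refine (Finset.sum_le_sum fun q hq => hb p hp q hq).trans ?_
        rw [Finset.sum_add_distrib, Finset.sum_ite_eq', if_pos hp, Finset.sum_ite_eq',
          if_pos (by rw [mem_offDiagPairs] at *; simpa using ne_comm.1 hp)]
    _ = _ := by
        rw [Finset.sum_add_distrib, ← Finset.sum_mul, ← Finset.sum_mul, ← Finset.sum_div,
          Finset.sum_add_distrib, hswap]
        ring

end IIDKernel

/-! ### The jackknife estimator in terms of row sums. -/

section JackknifeAlgebra

variable {h : ℝ → ℝ → ℝ} {n : ℕ}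

/-- The sum `∑_{j ≠ i} f i j`. -/
def rowSum (f : Fin n → Fin n → ℝ) (i : Fin n) : ℝ := ∑ j, if i ≠ j then f i j else 0

lemma sum_offDiagPairs (f : Fin n → Fin n → ℝ) :
    ∑ p ∈ IIDKernel.offDiagPairs n, f p.1 p.2 = ∑ i, rowSum f i := by
  rw [IIDKernel.offDiagPairs, Finset.sum_filter, Fintype.sum_prod_type]
  rfl

/-- Doubling turns unordered pairs into ordered ones; deleting the index `i` removes its row and its
column, which agree by symmetry. -/
lemma two_mul_sum_lt_eq (hs : ∀ x y, h x y = h y x) (x : Fin n → ℝ) (i : Fin n) :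
    2 * ∑ p : Fin n × Fin n with p.1 < p.2 ∧ p.1 ≠ i ∧ p.2 ≠ i, h (x p.1) (x p.2)
      = ∑ j, rowSum (fun a b => h (x a) (x b)) j - 2 * rowSum (fun a b => h (x a) (x b)) i := by
  have h1 : ∑ p : Fin n × Fin n with p.1 < p.2 ∧ p.1 ≠ i ∧ p.2 ≠ i, h (x p.1) (x p.2)
      = ∑ a, ∑ b, if a < b ∧ a ≠ i ∧ b ≠ i then h (x a) (x b) else 0 := by
    rw [Finset.sum_filter, Fintype.sum_prod_type]
  have h2 : ∑ a, ∑ b, (if a < b ∧ a ≠ i ∧ b ≠ i then h (x a) (x b) else 0)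
      = ∑ a, ∑ b, if b < a ∧ a ≠ i ∧ b ≠ i then h (x a) (x b) else 0 := by
    rw [Finset.sum_comm]
    refine Finset.sum_congr rfl fun a _ => Finset.sum_congr rfl fun b _ => ?_
    rw [hs (x b) (x a)]
    congr 1
    simp only [and_comm (a := b ≠ i)]
  have h3 : ∀ a b : Fin n, (if a < b ∧ a ≠ i ∧ b ≠ i then h (x a) (x b) else 0)
      + (if b < a ∧ a ≠ i ∧ b ≠ i then h (x a) (x b) else 0)
      = (if a ≠ b then h (x a) (x b) else 0)
        - (if a = i then (if i ≠ b then h (x i) (x b) else 0) else 0)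
        - (if b = i then (if i ≠ a then h (x i) (x a) else 0) else 0) := by
    intro a b
    by_cases ha : a = i
    · subst ha
      by_cases hb : b = a
      · subst hb; simp
      · simp [hb, Ne.symm hb]
    · by_cases hb : b = i
      · subst hb
        simp [ha, Ne.symm ha, hs (x b) (x a)]
      · rcases lt_trichotomy a b with hab | hab | hab
        · simp [ha, hb, hab, hab.ne, hab.le]
        · simp [hb, hab]
        · simp [ha, hb, hab, hab.ne', hab.le]
  rw [two_mul]
  nth_rewrite 2 [h1]
  rw [h2, h1, ← Finset.sum_add_distrib]
  simp only [← Finset.sum_add_distrib, h3, Finset.sum_sub_distrib]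
  rw [Finset.sum_comm (f := fun a b => if a = i then (if i ≠ b then h (x i) (x b) else 0) else 0)]
  simp only [Finset.sum_ite_eq', Finset.mem_univ, if_true]
  simp only [rowSum]
  ring

/-- Each difference `U^i - U_n` is `-2/((n-1)(n-2))` times the centred row sum of `i`, so the
estimator is a rescaled empirical variance of the row sums. -/
lemma jackknifeVar_eq (hs : ∀ x y, h x y = h y x) (hn : 3 ≤ n) (x : Fin n → ℝ) :
    jackknifeVar h x = (∑ i, (rowSum (fun a b => h (x a) (x b)) i
      - (∑ j, rowSum (fun a b => h (x a) (x b)) j) / n) ^ 2) / ((n - 1) * (n - 2) ^ 2) := by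
  have hn3 : (3 : ℝ) ≤ n := by exact_mod_cast hn
  have h0 : (n : ℝ) ≠ 0 := by linarith
  have h1 : (n : ℝ) - 1 ≠ 0 := by linarith
  have h2 : (n : ℝ) - 2 ≠ 0 := by linarith
  have hch : (((n - 1).choose 2 : ℕ) : ℝ) = (n - 1) * (n - 2) / 2 := by
    rw [Nat.cast_choose_two, Nat.cast_sub (by omega)]
    push_cast; ring
  have hd : ∀ i, uStatDelete h x i - uStat h x
      = -(2 / ((n - 1) * (n - 2))) * (rowSum (fun a b => h (x a) (x b)) i
        - (∑ j, rowSum (fun a b => h (x a) (x b)) j) / n) := by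
    intro i
    have e1 := two_mul_sum_lt_eq hs x i
    have e2 : ∑ p : Fin n × Fin n with p.1 ≠ p.2, h (x p.1) (x p.2)
        = ∑ i, rowSum (fun a b => h (x a) (x b)) i := sum_offDiagPairs fun a b => h (x a) (x b)
    rw [uStatDelete, uStat, e2, hch]
    rw [eq_div_of_mul_eq two_ne_zero ((mul_comm _ _).trans e1)]
    field_simp
    ring
  rw [jackknifeVar]
  simp only [hd, mul_pow, ← Finset.mul_sum]
  field_simp
  norm_num

/-- The reverse triangle inequality in Euclidean space. -/
lemma abs_sqrt_sum_sq_sub_le (a b : Fin n → ℝ) :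
    |√(∑ i, a i ^ 2) - √(∑ i, b i ^ 2)| ≤ √(∑ i, (a i - b i) ^ 2) := by
  have := abs_norm_sub_norm_le (WithLp.toLp 2 a) (WithLp.toLp 2 b)
  simpa [EuclideanSpace.norm_eq] using this

lemma sum_sq_sub_mean (hn : 1 ≤ n) (a : Fin n → ℝ) :
    ∑ i, (a i - (∑ j, a j) / n) ^ 2 = ∑ i, a i ^ 2 - n * ((∑ j, a j) / n) ^ 2 := by
  have h0 : (n : ℝ) ≠ 0 := by positivity
  simp only [sub_sq, Finset.sum_add_distrib, Finset.sum_sub_distrib, ← Finset.sum_mul,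
    ← Finset.mul_sum]
  simp
  field_simp
  ring

/-- The square root of the jackknife variance differs from the empirical standard deviation of
the projections by at most the size of the degenerate row sums. -/
lemma abs_sqrt_jackknifeVar_sub_le (hs : ∀ x y, h x y = h y x) (hn : 3 ≤ n) (x : Fin n → ℝ)
    (ν : Measure ℝ) :
    |√(jackknifeVar h x) - √((∑ i, kernelProj h ν (x i) ^ 2
        - n * ((∑ i, kernelProj h ν (x i)) / n) ^ 2) / (n - 1))|
      ≤ √((∑ i, rowSum (fun a b => kernelDeg h ν (x a) (x b)) i ^ 2)
        / ((n - 1) * (n - 2) ^ 2)) := by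
  have hn3 : (3 : ℝ) ≤ n := by exact_mod_cast hn
  have h0 : (0 : ℝ) < n := by linarith
  have h1 : (0 : ℝ) < n - 1 := by linarith
  have h2 : (0 : ℝ) < n - 2 := by linarith
  set r := rowSum fun a b => h (x a) (x b) with hr
  set K := rowSum fun a b => kernelDeg h ν (x a) (x b) with hK
  set g := fun i => kernelProj h ν (x i) with hg
  -- The coefficient is `n - 2`: `g i` occurs `n - 1` times, and completing `∑_{j ≠ i} g j` to the
  -- full sum costs one more.
  have hrow : ∀ i, r i = ((n - 1) * kernelMean h ν + ∑ j, g j) + (n - 2) * g i + K i := by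
    intro i
    have e : ∀ j, (if i ≠ j then h (x i) (x j) else 0)
        = (kernelMean h ν + g i + g j - if i = j then kernelMean h ν + g i + g j else 0)
          + if i ≠ j then kernelDeg h ν (x i) (x j) else 0 := by
      intro j
      by_cases hij : i = j
      · simp [hij]
      · simp [hij, kernelDeg, hg]
    rw [hr, hK]
    simp only [rowSum, e, Finset.sum_add_distrib, Finset.sum_sub_distrib, Finset.sum_ite_eq,
      Finset.mem_univ, if_true, Finset.sum_const, Finset.card_univ, Fintype.card_fin, nsmul_eq_mul]
    ring
  have hdev : ∀ i, r i - (∑ j, r j) / n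
      = (n - 2) * (g i - (∑ j, g j) / n) + (K i - (∑ j, K j) / n) := by
    intro i
    have e : ∑ j, r j = n * ((n - 1) * kernelMean h ν + ∑ j, g j) + (n - 2) * ∑ j, g j
        + ∑ j, K j := by
      simp only [hrow, Finset.sum_add_distrib, ← Finset.mul_sum]
      simp
      ring
    rw [e, hrow]
    field_simp
    ring
  set C := √(((n : ℝ) - 1) * (n - 2) ^ 2) with hC
  have hCpos : 0 < C := Real.sqrt_pos.2 (by positivity)
  have hA : √(jackknifeVar h x) = √(∑ i, (r i - (∑ j, r j) / n) ^ 2) / C := by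
    rw [jackknifeVar_eq hs hn, Real.sqrt_div' _ (by positivity)]
  have hB : √((∑ i, kernelProj h ν (x i) ^ 2
        - n * ((∑ i, kernelProj h ν (x i)) / n) ^ 2) / (n - 1))
      = √(∑ i, ((n - 2) * (g i - (∑ j, g j) / n)) ^ 2) / C := by
    rw [hC, ← Real.sqrt_div' _ (by positivity)]
    congr 1
    simp only [mul_pow, ← Finset.mul_sum]
    rw [sum_sq_sub_mean (by omega)]
    simp only [hg]
    field_simp
  rw [hA, hB, ← sub_div, abs_div, abs_of_pos hCpos, Real.sqrt_div' _ (by positivity), ← hC]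
  gcongr
  refine (abs_sqrt_sum_sq_sub_le _ _).trans (Real.sqrt_le_sqrt ?_)
  have e : ∀ i, r i - (∑ j, r j) / n - (n - 2) * (g i - (∑ j, g j) / n)
      = K i - (∑ j, K j) / n := by
    intro i; rw [hdev]; ring
  simp only [e]
  -- Centring can only decrease a sum of squares, so the mean of the degenerate row sums may be
  -- dropped.
  rw [sum_sq_sub_mean (by omega)]
  have : 0 ≤ (n : ℝ) * ((∑ j, K j) / n) ^ 2 := by positivity
  linarith

end JackknifeAlgebra

/-! ### Consistency of the jackknife estimator. -/

namespace IIDKernel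

variable {Ω : Type*} [MeasurableSpace Ω] {μ : Measure Ω} [IsProbabilityMeasure μ]
  {h : ℝ → ℝ → ℝ} {X : ℕ → Ω → ℝ}

/-- The variance of the projection. -/
noncomputable def sigmaSq (_ : IIDKernel μ h X) : ℝ := ∫ ω, kernelProj h (μ.map (X 0)) (X 0 ω) ^ 2 ∂μ

/-- The strong law for `g(X_i)` and for `g(X_i)²`; the projection has mean zero. -/
lemma ae_tendsto_empirical_var (H : IIDKernel μ h X) {n : ℕ → ℕ} (hn : Tendsto n atTop atTop) :
    ∀ᵐ ω ∂μ, Tendsto (fun k => √((∑ i : Fin (n k), H.g (X i ω) ^ 2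
      - n k * ((∑ i : Fin (n k), H.g (X i ω)) / n k) ^ 2) / ((n k : ℝ) - 1)))
      atTop (𝓝 (√H.sigmaSq)) := by
  have hgm := H.measurable_g
  have h1 := strong_law_ae_real (fun i ω => H.g (X i ω)) ((H.memLp_g 0).integrable (by norm_num))
    (fun i j hij => (H.indep.indepFun hij).comp hgm hgm) (fun i => (H.ident i).comp hgm)
  have hgm2 : Measurable fun x => H.g x ^ 2 := hgm.pow_const 2
  have h2 := strong_law_ae_real (fun i ω => H.g (X i ω) ^ 2) (H.memLp_g 0).integrable_sq
    (fun i j hij => (H.indep.indepFun hij).comp hgm2 hgm2) (fun i => (H.ident i).comp hgm2)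
  rw [H.integral_g 0] at h1
  filter_upwards [h1, h2] with ω h1 h2
  have h1' := h1.comp hn
  have h2' := h2.comp hn
  have hnr : Tendsto (fun k => (n k : ℝ)) atTop atTop := tendsto_natCast_atTop_atTop.comp hn
  have hinv : Tendsto (fun k => ((n k : ℝ))⁻¹) atTop (𝓝 0) := tendsto_inv_atTop_zero.comp hnr
  have h3 := (h2'.sub (h1'.pow 2)).div (hinv.const_sub 1) (by norm_num)
  simp only [ne_eq, OfNat.ofNat_ne_zero, not_false_eq_true, zero_pow, sub_zero, div_one] at h3
  refine (Real.continuous_sqrt.tendsto _).comp (h3.congr' ?_)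
  filter_upwards [hn.eventually_ge_atTop 2] with k hk
  have hk2 : (2 : ℝ) ≤ n k := by exact_mod_cast hk
  have hk0 : (n k : ℝ) ≠ 0 := by linarith
  have hk1 : (n k : ℝ) - 1 ≠ 0 := by linarith
  simp only [Function.comp_apply, Finset.sum_range, Pi.div_apply]
  field_simp

lemma integral_rowSum_sq_le (H : IIDKernel μ h X) {n : ℕ} (i : Fin n) :
    Integrable (fun ω => rowSum (fun a b : Fin n => H.deg (X a ω) (X b ω)) i ^ 2) μ ∧
    ∫ ω, rowSum (fun a b : Fin n => H.deg (X a ω) (X b ω)) i ^ 2 ∂μ ≤ 2 * H.degSq * n := by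
  set c : Fin n × Fin n → ℝ := fun p => if p.1 = i then 1 else 0 with hc
  have e : ∀ ω, rowSum (fun a b : Fin n => H.deg (X a ω) (X b ω)) i
      = ∑ p ∈ offDiagPairs n, c p * H.deg (X p.1 ω) (X p.2 ω) := by
    intro ω
    rw [sum_offDiagPairs (fun a b => c (a, b) * H.deg (X a ω) (X b ω))]
    rw [Finset.sum_eq_single i]
    · simp [rowSum, hc]
    · intro b _ hb
      simp [rowSum, hc, hb]
    · simp
  simp only [e]
  refine ⟨(H.memLp_sum_deg c).integrable_sq, (H.integral_sum_deg_sq_le c).trans ?_⟩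
  have hK := H.degSq_nonneg
  gcongr
  calc ∑ p ∈ offDiagPairs n, c p ^ 2 ≤ ∑ p, c p ^ 2 :=
        Finset.sum_le_univ_sum_of_nonneg fun _ => sq_nonneg _
    _ = n := by
        rw [Fintype.sum_prod_type, Finset.sum_eq_single i]
        · simp [hc]
        · intro b _ hb
          simp [hc, hb]
        · simp

/-- Consistency of the jackknife variance estimator. -/
theorem tendstoInMeasure_sqrt_jackknifeVar (H : IIDKernel μ h X) {n : ℕ → ℕ}
    (hn : Tendsto n atTop atTop) :
    TendstoInMeasure μ (fun k ω => √(jackknifeVar h (sample X (n k) ω))) atTop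
      (fun _ => √H.sigmaSq) := by
  have hgm := H.measurable_g
  have hB : TendstoInMeasure μ (fun k ω => √((∑ i : Fin (n k), H.g (X i ω) ^ 2
      - n k * ((∑ i : Fin (n k), H.g (X i ω)) / n k) ^ 2) / ((n k : ℝ) - 1))) atTop
      (fun _ => √H.sigmaSq) := by
    refine tendstoInMeasure_of_tendsto_ae (fun k => ?_) (H.ae_tendsto_empirical_var hn)
    have : ∀ i, Measurable fun ω => H.g (X i ω) := fun i => hgm.comp (H.meas_X i)
    exact Measurable.aestronglyMeasurable (by fun_prop)
  -- Each of the `n` rows has second moment of order `n`, so the numerator is of order `n²` in `L¹`,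
  -- against a cubic denominator.
  have hC : TendstoInMeasure μ (fun k ω =>
      (∑ i : Fin (n k), rowSum (fun a b : Fin (n k) => H.deg (X a ω) (X b ω)) i ^ 2)
        / (((n k : ℝ) - 1) * (n k - 2) ^ 2)) atTop (fun _ => 0) := by
    refine tendstoInMeasure_zero_of_integral_abs_le
      (b := fun k => (n k * (2 * H.degSq * n k)) / (((n k : ℝ) - 1) * (n k - 2) ^ 2)) ?_ ?_
    · filter_upwards [hn.eventually_ge_atTop 3] with k hk
      have hk3 : (3 : ℝ) ≤ n k := by exact_mod_cast hk
      have hk1 : (0 : ℝ) < n k - 1 := by linarith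
      have hi := fun i : Fin (n k) => H.integral_rowSum_sq_le i
      have hint := integrable_finsetSum Finset.univ fun i _ => (hi i).1
      refine ⟨hint.div_const _, ?_⟩
      have e : ∀ ω, |(∑ i : Fin (n k), rowSum (fun a b : Fin (n k) => H.deg (X a ω) (X b ω)) i ^ 2)
        / (((n k : ℝ) - 1) * (n k - 2) ^ 2)|
        = (∑ i : Fin (n k), rowSum (fun a b : Fin (n k) => H.deg (X a ω) (X b ω)) i ^ 2)
        / (((n k : ℝ) - 1) * (n k - 2) ^ 2) := fun ω => abs_of_nonneg (by positivity)
      simp only [e]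
      rw [integral_div, integral_finsetSum _ fun i _ => (hi i).1]
      gcongr
      refine (Finset.sum_le_sum fun i _ => (hi i).2).trans ?_
      simp
    · have hnr : Tendsto (fun k => (n k : ℝ)) atTop atTop := tendsto_natCast_atTop_atTop.comp hn
      have hinv : Tendsto (fun k => ((n k : ℝ))⁻¹) atTop (𝓝 0) := tendsto_inv_atTop_zero.comp hnr
      have h3 := (hinv.const_mul (2 * H.degSq)).div
        ((hinv.const_sub 1).mul (((hinv.const_mul 2).const_sub 1).pow 2)) (by norm_num)
      simp only [mul_zero, sub_zero, zero_div] at h3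
      refine h3.congr' ?_
      filter_upwards [hn.eventually_ge_atTop 3] with k hk
      have hk3 : (3 : ℝ) ≤ n k := by exact_mod_cast hk
      have hk0 : (n k : ℝ) ≠ 0 := by linarith
      have hk1 : (n k : ℝ) - 1 ≠ 0 := by linarith
      have hk2 : (n k : ℝ) - 2 ≠ 0 := by linarith
      simp only [Pi.div_apply]
      field_simp
  have hC' := TendstoInMeasure.comp_continuousAt hC (f := Real.sqrt)
    Real.continuous_sqrt.continuousAt
  rw [Real.sqrt_zero] at hC'
  refine tendstoInMeasure_of_abs_sub_le hB hC' ?_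
  filter_upwards [hn.eventually_ge_atTop 3] with k hk ω
  exact abs_sqrt_jackknifeVar_sub_le H.symm hk (sample X (n k) ω) (μ.map (X 0))

end IIDKernel

/-! ### Deterministic regular weights. -/

/-- Sequences of weights `w_k` on `n_k` observations with total mass `m_k = o(n_k²)` whose
standardizations `c_i = (w_i - m / n) / √m` satisfy `∑ c_i² → 1` and `∑ c_i⁴ → 0`. -/
structure IsRegularWeights (n m : ℕ → ℕ) (w : ∀ k, Fin (n k) → ℕ) : Prop where
  tendsto_n : Tendsto n atTop atTop
  tendsto_m : Tendsto m atTop atTop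
  isLittleO : (fun k => (m k : ℝ)) =o[atTop] (fun k => (n k : ℝ) ^ 2)
  sum_eq : ∀ k, ∑ i, w k i = m k
  sq : Tendsto (fun k => (∑ i, ((w k i : ℝ) - m k / n k) ^ 2) / m k) atTop (𝓝 1)
  fourth : Tendsto (fun k => (∑ i, ((w k i : ℝ) - m k / n k) ^ 4) / (m k : ℝ) ^ 2) atTop (𝓝 0)

namespace IsRegularWeights

variable {n m : ℕ → ℕ} {w : ∀ k, Fin (n k) → ℕ}

lemma tendsto_sqrt_div (W : IsRegularWeights n m w) :
    Tendsto (fun k => √(m k) / n k) atTop (𝓝 0) := by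
  have h := (Real.continuous_sqrt.tendsto 0).comp W.isLittleO.tendsto_div_nhds_zero
  rw [Real.sqrt_zero] at h
  refine h.congr fun k => ?_
  rw [Function.comp_apply, Real.sqrt_div (Nat.cast_nonneg _), Real.sqrt_sq (Nat.cast_nonneg _)]

lemma tendsto_sqrt_div_sub_one (W : IsRegularWeights n m w) :
    Tendsto (fun k => √(m k) / ((n k : ℝ) - 1)) atTop (𝓝 0) := by
  have h := W.tendsto_sqrt_div.mul_const 2
  rw [zero_mul] at h
  refine tendsto_of_tendsto_of_tendsto_of_le_of_le' tendsto_const_nhds h ?_ ?_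
  · filter_upwards [W.tendsto_n.eventually_ge_atTop 2] with k hk
    have : (2 : ℝ) ≤ n k := by exact_mod_cast hk
    exact div_nonneg (Real.sqrt_nonneg _) (by linarith)
  · filter_upwards [W.tendsto_n.eventually_ge_atTop 2] with k hk
    have : (2 : ℝ) ≤ n k := by exact_mod_cast hk
    rw [div_mul_eq_mul_div, div_le_div_iff₀ (by linarith) (by linarith), mul_assoc]
    gcongr
    linarith

lemma sum_sq_eq (W : IsRegularWeights n m w) {k : ℕ} (hk : 1 ≤ n k) :
    ∑ i, (w k i : ℝ) ^ 2
      = ∑ i, ((w k i : ℝ) - m k / n k) ^ 2 + (m k : ℝ) ^ 2 / n k := by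
  have h := sum_sq_sub_mean hk fun i => (w k i : ℝ)
  have hs : ∑ i, (w k i : ℝ) = m k := by exact_mod_cast W.sum_eq k
  have h0 : (n k : ℝ) ≠ 0 := by positivity
  rw [hs] at h
  rw [h]
  field_simp
  ring

/-- The scaled sum of squares of the weights. -/
noncomputable def scaledSq (_ : IsRegularWeights n m w) (k : ℕ) : ℝ :=
  √(m k) * ((∑ i, (w k i : ℝ) ^ 2) / ((m k : ℝ) * (m k - 1)))

/-- By `sum_sq_eq` the quantity behaves like `1/√m + √m/n`; the second summand is where `m = o(n²)`
enters. All remainders coming from the bootstrap statistic reduce to this limit. -/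
lemma tendsto_scaledSq (W : IsRegularWeights n m w) : Tendsto W.scaledSq atTop (𝓝 0) := by
  have hmr : Tendsto (fun k => (m k : ℝ)) atTop atTop :=
    tendsto_natCast_atTop_atTop.comp W.tendsto_m
  have hinv : Tendsto (fun k => ((m k : ℝ))⁻¹) atTop (𝓝 0) := tendsto_inv_atTop_zero.comp hmr
  have hsqrt : Tendsto (fun k => (√(m k))⁻¹) atTop (𝓝 0) :=
    tendsto_inv_atTop_zero.comp (Real.tendsto_sqrt_atTop.comp hmr)
  have h := ((W.sq.mul hsqrt).add W.tendsto_sqrt_div).div (hinv.const_sub 1) (by norm_num)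
  simp only [mul_zero, zero_add, sub_zero, zero_div] at h
  refine h.congr' ?_
  filter_upwards [W.tendsto_n.eventually_ge_atTop 1, W.tendsto_m.eventually_ge_atTop 2]
    with k hn hm
  have hm2 : (2 : ℝ) ≤ m k := by exact_mod_cast hm
  have hn0 : (n k : ℝ) ≠ 0 := by positivity
  have hm0 : (m k : ℝ) ≠ 0 := by linarith
  have hm1 : (m k : ℝ) - 1 ≠ 0 := by linarith
  have hs0 : √(m k : ℝ) ≠ 0 := (Real.sqrt_pos.2 (by linarith)).ne'
  have hss : √(m k : ℝ) ^ 2 = m k := Real.sq_sqrt (by linarith)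
  rw [scaledSq, W.sum_sq_eq hn]
  simp only [Pi.div_apply]
  set A := ∑ i, ((w k i : ℝ) - m k / n k) ^ 2
  have e : (√(m k : ℝ))⁻¹ = √(m k : ℝ) / m k := by
    rw [inv_eq_one_div, div_eq_div_iff hs0 hm0, one_mul, ← pow_two, hss]
  rw [e]
  field_simp

/-- The standardized weights. -/
noncomputable def std (_ : IsRegularWeights n m w) (k : ℕ) (i : Fin (n k)) : ℝ :=
  ((w k i : ℝ) - m k / n k) / √(m k)

lemma tendsto_sum_std_sq (W : IsRegularWeights n m w) :
    Tendsto (fun k => ∑ i, W.std k i ^ 2) atTop (𝓝 1) := by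
  refine W.sq.congr fun k => ?_
  simp only [std, div_pow, Real.sq_sqrt (Nat.cast_nonneg _), Finset.sum_div]

/-- The largest standardized weight is dominated by the `ℓ⁴` norm. -/
lemma eventually_abs_std_le (W : IsRegularWeights n m w) {ε : ℝ} (hε : 0 < ε) :
    ∀ᶠ k in atTop, ∀ i, |W.std k i| ≤ ε := by
  filter_upwards [W.fourth.eventually_lt_const (show (0 : ℝ) < ε ^ 4 by positivity)] with k hk i
  have e : ∑ i, W.std k i ^ 4 = (∑ i, ((w k i : ℝ) - m k / n k) ^ 4) / (m k : ℝ) ^ 2 := by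
    have h4 : √(m k : ℝ) ^ 4 = (m k : ℝ) ^ 2 := by
      rw [show 4 = 2 * 2 from rfl, pow_mul, Real.sq_sqrt (Nat.cast_nonneg _)]
    simp only [std, div_pow, h4, Finset.sum_div]
  have h1 : W.std k i ^ 4 ≤ ∑ i, W.std k i ^ 4 :=
    Finset.single_le_sum (f := fun i => W.std k i ^ 4) (fun i _ => by positivity)
      (Finset.mem_univ i)
  have h2 : |W.std k i| ^ 4 ≤ ε ^ 4 := by
    rw [← abs_pow, abs_of_nonneg (by positivity)]
    linarith
  exact le_of_pow_le_pow_left₀ (by norm_num) hε.le h2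

end IsRegularWeights

/-! ### Linearization of the weighted `u`-statistic. -/

/-- The bootstrap `u`-statistic as a function of the weights. -/
noncomputable def weightedU (h : ℝ → ℝ → ℝ) {n : ℕ} (x : Fin n → ℝ) (w : Fin n → ℕ) (m : ℕ) : ℝ :=
  (∑ p ∈ IIDKernel.offDiagPairs n, (w p.1 : ℝ) * w p.2 * h (x p.1) (x p.2)) /
    ((m : ℝ) * ((m : ℝ) - 1))

/-- Hoeffding decomposition of a weighted double sum. -/
lemma sum_offDiag_mul_eq {h : ℝ → ℝ → ℝ} {n : ℕ} (x : Fin n → ℝ) (ν : Measure ℝ)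
    (b : Fin n → ℝ) :
    ∑ p ∈ IIDKernel.offDiagPairs n, b p.1 * b p.2 * h (x p.1) (x p.2)
      = kernelMean h ν * ((∑ i, b i) ^ 2 - ∑ i, b i ^ 2)
        + 2 * ∑ i, b i * ((∑ j, b j) - b i) * kernelProj h ν (x i)
        + ∑ p ∈ IIDKernel.offDiagPairs n, b p.1 * b p.2 * kernelDeg h ν (x p.1) (x p.2) := by
  set θ := kernelMean h ν
  set g := fun i => kernelProj h ν (x i) with hg
  set B := ∑ i, b i with hB
  rw [sum_offDiagPairs (fun i j => b i * b j * h (x i) (x j)),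
    sum_offDiagPairs (fun i j => b i * b j * kernelDeg h ν (x i) (x j))]
  have hrow : ∀ i, rowSum (fun i j => b i * b j * h (x i) (x j)) i
      = b i * (θ + g i) * (B - b i) + b i * (∑ j, b j * g j - b i * g i)
        + rowSum (fun i j => b i * b j * kernelDeg h ν (x i) (x j)) i := by
    intro i
    have e : ∀ j, (if i ≠ j then b i * b j * h (x i) (x j) else 0)
        = (b i * (θ + g i) * b j - if i = j then b i * (θ + g i) * b j else 0)
          + (b i * (b j * g j) - if i = j then b i * (b j * g j) else 0)
          + if i ≠ j then b i * b j * kernelDeg h ν (x i) (x j) else 0 := by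
      intro j
      by_cases hij : i = j
      · simp [hij]
      · simp only [hij, ne_eq, not_false_eq_true, if_true, if_false, kernelDeg, hg]
        ring
    simp only [rowSum, e, Finset.sum_add_distrib, Finset.sum_sub_distrib, Finset.sum_ite_eq,
      Finset.mem_univ, if_true, ← Finset.mul_sum]
    ring
  have hsum : ∑ i, (b i * (θ + g i) * (B - b i) + b i * (∑ j, b j * g j - b i * g i))
      = θ * (B ^ 2 - ∑ i, b i ^ 2) + 2 * ∑ i, b i * (B - b i) * g i := by
    have e : ∀ i, b i * (θ + g i) * (B - b i) + b i * (∑ j, b j * g j - b i * g i)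
        = θ * (B * b i) - θ * b i ^ 2 + (b i * (B - b i) * g i)
          + b i * ∑ j, b j * g j - b i ^ 2 * g i := fun i => by ring
    have e2 : ∀ i, b i * (B - b i) * g i = B * (b i * g i) - b i ^ 2 * g i := fun i => by ring
    simp only [e, Finset.sum_add_distrib, Finset.sum_sub_distrib, ← Finset.mul_sum,
      ← Finset.sum_mul, ← hB]
    simp only [e2, Finset.sum_sub_distrib, ← Finset.mul_sum]
    ring
  simp only [hrow]
  rw [Finset.sum_add_distrib, hsum]

/-- Decomposition of the standardized difference of the bootstrap and the original `u`-statistic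
into its linear part and remainder terms. -/
lemma weightedU_sub_uStat_eq {h : ℝ → ℝ → ℝ} {n m : ℕ} (x : Fin n → ℝ) (ν : Measure ℝ)
    (w : Fin n → ℕ) (hw : ∑ i, w i = m) (hn : 2 ≤ n) (hm : 2 ≤ m) :
    √m * (weightedU h x w m - uStat h x)
        - 2 * ∑ i, ((w i : ℝ) - m / n) / √m * kernelProj h ν (x i)
      = √m * (-kernelMean h ν * ((∑ i, (w i : ℝ) ^ 2 - m) / (m * (m - 1))))
        + √m * (-2 / (m * (m - 1))) * ∑ i, ((w i : ℝ) * (w i - 1)) * kernelProj h ν (x i)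
        + √m / (m * (m - 1)) * ∑ p ∈ IIDKernel.offDiagPairs n,
            ((w p.1 : ℝ) * w p.2) * kernelDeg h ν (x p.1) (x p.2)
        + -(√m / (n * (n - 1))) * ∑ p ∈ IIDKernel.offDiagPairs n,
            (1 : ℝ) * kernelDeg h ν (x p.1) (x p.2) := by
  have hn2 : (2 : ℝ) ≤ n := by exact_mod_cast hn
  have hm2 : (2 : ℝ) ≤ m := by exact_mod_cast hm
  have hn0 : (n : ℝ) ≠ 0 := by linarith
  have hn1 : (n : ℝ) - 1 ≠ 0 := by linarith
  have hm0 : (m : ℝ) ≠ 0 := by linarith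
  have hm1 : (m : ℝ) - 1 ≠ 0 := by linarith
  have hs0 : √(m : ℝ) ≠ 0 := (Real.sqrt_pos.2 (by linarith)).ne'
  have hss : √(m : ℝ) * √(m : ℝ) = m := Real.mul_self_sqrt (by linarith)
  have hwr : ∑ i, (w i : ℝ) = m := by exact_mod_cast hw
  -- The same decomposition serves both statistics: coefficients `w_i` with total `m`, and
  -- coefficients `1` with total `n`.
  have h1 := sum_offDiag_mul_eq (h := h) x ν fun i => (w i : ℝ)
  have h2 := sum_offDiag_mul_eq (h := h) x ν fun _ => (1 : ℝ)
  have hU : uStat h x = (∑ p ∈ IIDKernel.offDiagPairs n, (1 : ℝ) * 1 * h (x p.1) (x p.2))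
      / ((n : ℝ) * ((n : ℝ) - 1)) := by
    simp only [one_mul]; rfl
  rw [weightedU, hU, h1, h2, hwr]
  simp only [Finset.sum_const, Finset.card_univ, Fintype.card_fin, nsmul_eq_mul, one_mul, mul_one,
    one_pow, ← Finset.mul_sum]
  set g := fun i => kernelProj h ν (x i)
  -- Writing `m - w_i = (m - 1) - (w_i - 1)` cancels the factor `m - 1` in the denominator and
  -- leaves the linear coefficient `w_i / m`.
  have hA : ∑ i, (w i : ℝ) * (m - w i) * g i
      = (m - 1) * ∑ i, (w i : ℝ) * g i - ∑ i, (w i : ℝ) * (w i - 1) * g i := by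
    rw [Finset.mul_sum, ← Finset.sum_sub_distrib]
    exact Finset.sum_congr rfl fun i _ => by ring
  have hB : ∑ i, ((w i : ℝ) - m / n) / √m * g i
      = √m / m * (∑ i, (w i : ℝ) * g i) - √m / n * ∑ i, g i := by
    rw [Finset.mul_sum, Finset.mul_sum, ← Finset.sum_sub_distrib]
    refine Finset.sum_congr rfl fun i _ => ?_
    have e : (√(m : ℝ))⁻¹ = √(m : ℝ) / m := by
      rw [inv_eq_one_div, div_eq_div_iff hs0 hm0, one_mul, hss]
    rw [div_eq_mul_inv _ (√(m : ℝ)), e]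
    field_simp
  change √m * ((kernelMean h ν * ((m : ℝ) ^ 2 - ∑ i, (w i : ℝ) ^ 2)
    + 2 * (∑ i, (w i : ℝ) * (m - w i) * g i) + _) / _ - _) - 2 * (∑ i, _ / √m * g i)
    = _ + _ * (∑ i, (w i : ℝ) * (w i - 1) * g i) + _ + _
  rw [hA, hB]
  field_simp
  ring

/-! ### Negligibility of the remainders. -/

namespace IIDKernel

variable {Ω : Type*} [MeasurableSpace Ω] {μ : Measure Ω}
  {h : ℝ → ℝ → ℝ} {X : ℕ → Ω → ℝ} {n m : ℕ → ℕ} {w : ∀ k, Fin (n k) → ℕ}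

lemma integral_abs_comp (H : IIDKernel μ h X) {f : ℝ → ℝ} (hf : Measurable f) (i : ℕ) :
    ∫ ω, |f (X i ω)| ∂μ = ∫ ω, |f (X 0 ω)| ∂μ :=
  ((H.ident i).comp (hf.abs)).integral_eq

lemma tendstoInMeasure_const_mul_zero {F : ℕ → Ω → ℝ} {a b : ℕ → ℝ}
    (hF : ∀ᶠ k in atTop, Integrable (F k) μ ∧ |a k| * ∫ ω, |F k ω| ∂μ ≤ b k)
    (hb : Tendsto b atTop (𝓝 0)) :
    TendstoInMeasure μ (fun k ω => a k * F k ω) atTop (fun _ => 0) := by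
  refine tendstoInMeasure_zero_of_integral_abs_le ?_ hb
  filter_upwards [hF] with k hk
  refine ⟨hk.1.const_mul _, ?_⟩
  simp only [abs_mul, integral_const_mul]
  exact hk.2

lemma integral_abs_sum_mul_le {ι : Type*} (s : Finset ι) {F : ι → Ω → ℝ} {b : ι → ℝ} {C : ℝ}
    (hF : ∀ i ∈ s, Integrable (F i) μ) (hC : ∀ i ∈ s, ∫ ω, |F i ω| ∂μ ≤ C)
    (hb : ∀ i ∈ s, 0 ≤ b i) :
    Integrable (fun ω => ∑ i ∈ s, b i * F i ω) μ ∧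
      ∫ ω, |∑ i ∈ s, b i * F i ω| ∂μ ≤ C * ∑ i ∈ s, b i := by
  have hi := integrable_finsetSum s fun i hi => (hF i hi).const_mul (b i)
  have hi' := fun i (hi : i ∈ s) => (hF i hi).abs.const_mul (b i)
  refine ⟨hi, ?_⟩
  calc ∫ ω, |∑ i ∈ s, b i * F i ω| ∂μ ≤ ∫ ω, ∑ i ∈ s, b i * |F i ω| ∂μ := by
        refine integral_mono hi.abs (integrable_finsetSum s hi') fun ω => ?_
        refine (Finset.abs_sum_le_sum_abs _ _).trans (Finset.sum_le_sum fun i hi => ?_)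
        rw [abs_mul, abs_of_nonneg (hb i hi)]
    _ = ∑ i ∈ s, b i * ∫ ω, |F i ω| ∂μ := by
        rw [integral_finsetSum s hi']
        simp only [integral_const_mul]
    _ ≤ ∑ i ∈ s, b i * C := Finset.sum_le_sum fun i hi =>
        mul_le_mul_of_nonneg_left (hC i hi) (hb i hi)
    _ = C * ∑ i ∈ s, b i := by rw [← Finset.sum_mul, mul_comm]

variable [IsProbabilityMeasure μ]

lemma integral_abs_sum_deg_le (H : IIDKernel μ h X) {n : ℕ} (c : Fin n × Fin n → ℝ) :
    ∫ ω, |∑ p ∈ offDiagPairs n, c p * H.deg (X p.1 ω) (X p.2 ω)| ∂μ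
      ≤ √(2 * H.degSq) * √(∑ p ∈ offDiagPairs n, c p ^ 2) := by
  rw [← Real.sqrt_mul (by have := H.degSq_nonneg; positivity)]
  exact integral_abs_le_sqrt (H.memLp_sum_deg c) (H.integral_sum_deg_sq_le c)

/-- The difference of the bootstrap and the original `u`-statistic is asymptotically a weighted
sum of the projections. -/
theorem tendstoInMeasure_weightedU_remainder (H : IIDKernel μ h X)
    (W : IsRegularWeights n m w) :
    TendstoInMeasure μ (fun k ω =>
      √(m k) * (weightedU h (sample X (n k) ω) (w k) (m k) - uStat h (sample X (n k) ω))
        - 2 * ∑ i, W.std k i * H.g (X i ω)) atTop (fun _ => 0) := by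
  have hq := W.tendsto_scaledSq
  have hev : ∀ᶠ k in atTop, 2 ≤ n k ∧ 2 ≤ m k :=
    (W.tendsto_n.eventually_ge_atTop 2).and (W.tendsto_m.eventually_ge_atTop 2)
  -- Weights are natural numbers, so `w ≤ w²`; this makes `∑ w_i² - m` and each `w_i (w_i - 1)`
  -- nonnegative.
  have hle : ∀ k (i : Fin (n k)), (w k i : ℝ) ≤ (w k i : ℝ) ^ 2 := fun k i => by
    exact_mod_cast Nat.le_self_pow two_ne_zero _
  have hW2 : ∀ k, (m k : ℝ) ≤ ∑ i, (w k i : ℝ) ^ 2 := fun k => by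
    rw [← W.sum_eq k, Nat.cast_sum]
    exact Finset.sum_le_sum fun i _ => hle k i
  have h1 : TendstoInMeasure μ (fun k (_ : Ω) => √(m k) * (-kernelMean h (μ.map (X 0)) *
      ((∑ i, (w k i : ℝ) ^ 2 - m k) / (m k * ((m k : ℝ) - 1))))) atTop (fun _ => 0) := by
    refine tendstoInMeasure_const_of_tendsto ?_
    have hb := hq.const_mul |kernelMean h (μ.map (X 0))|
    rw [mul_zero] at hb
    refine squeeze_zero_norm' ?_ hb
    filter_upwards [hev] with k ⟨_, hm⟩
    have hm2 : (2 : ℝ) ≤ m k := by exact_mod_cast hm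
    have hm1 : (0 : ℝ) < (m k : ℝ) - 1 := by linarith
    rw [Real.norm_eq_abs, abs_mul, abs_mul, abs_neg, abs_of_nonneg (Real.sqrt_nonneg _),
      abs_of_nonneg (show 0 ≤ (∑ i, (w k i : ℝ) ^ 2 - m k) / (m k * ((m k : ℝ) - 1)) from
        div_nonneg (by linarith [hW2 k]) (by positivity)),
      IsRegularWeights.scaledSq, mul_left_comm]
    gcongr
    linarith
  have h2 : TendstoInMeasure μ (fun k ω => √(m k) * (-2 / (m k * ((m k : ℝ) - 1))) *
      ∑ i, ((w k i : ℝ) * (w k i - 1)) * H.g (X i ω)) atTop (fun _ => 0) := by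
    have hb := hq.const_mul (2 * ∫ ω, |H.g (X 0 ω)| ∂μ)
    rw [mul_zero] at hb
    refine tendstoInMeasure_const_mul_zero ?_ hb
    filter_upwards [hev] with k ⟨_, hm⟩
    have hm2 : (2 : ℝ) ≤ m k := by exact_mod_cast hm
    have hm1 : (0 : ℝ) < (m k : ℝ) - 1 := by linarith
    have hs := integral_abs_sum_mul_le (μ := μ) Finset.univ
      (F := fun (i : Fin (n k)) ω => H.g (X i ω)) (b := fun i => (w k i : ℝ) * (w k i - 1))
      (fun i _ => (H.memLp_g i).integrable (by norm_num))
      (fun i _ => (H.integral_abs_comp H.measurable_g i).le)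
      (fun i _ => by have := hle k i; nlinarith)
    refine ⟨hs.1, (mul_le_mul_of_nonneg_left hs.2 (abs_nonneg _)).trans ?_⟩
    have hI : 0 ≤ ∫ ω, |H.g (X 0 ω)| ∂μ := integral_nonneg fun _ => abs_nonneg _
    have hsum : ∑ i, (w k i : ℝ) * (w k i - 1) ≤ ∑ i, (w k i : ℝ) ^ 2 :=
      Finset.sum_le_sum fun i _ => by
        have : (0 : ℝ) ≤ w k i := Nat.cast_nonneg _
        nlinarith
    rw [abs_mul, abs_div, abs_of_nonneg (Real.sqrt_nonneg _), abs_neg, abs_two,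
      abs_of_nonneg (show (0 : ℝ) ≤ m k * ((m k : ℝ) - 1) by positivity),
      IsRegularWeights.scaledSq]
    calc _ ≤ √(m k) * (2 / (m k * ((m k : ℝ) - 1))) *
          ((∫ ω, |H.g (X 0 ω)| ∂μ) * ∑ i, (w k i : ℝ) ^ 2) := by gcongr
      _ = _ := by ring
  have h3 : TendstoInMeasure μ (fun k ω => √(m k) / (m k * ((m k : ℝ) - 1)) *
      ∑ p ∈ offDiagPairs (n k), ((w k p.1 : ℝ) * w k p.2) * H.deg (X p.1 ω) (X p.2 ω))
      atTop (fun _ => 0) := by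
    have hb := hq.const_mul (√(2 * H.degSq))
    rw [mul_zero] at hb
    refine tendstoInMeasure_const_mul_zero ?_ hb
    filter_upwards [hev] with k ⟨_, hm⟩
    have hm2 : (2 : ℝ) ≤ m k := by exact_mod_cast hm
    have hm1 : (0 : ℝ) < (m k : ℝ) - 1 := by linarith
    refine ⟨(H.memLp_sum_deg _).integrable (by norm_num),
      (mul_le_mul_of_nonneg_left (H.integral_abs_sum_deg_le _) (abs_nonneg _)).trans ?_⟩
    -- The sum over all pairs factors as `(∑ w_i²)²`, so the root of the second moment is again of
    -- order `∑ w_i²`.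
    have hsum : √(∑ p ∈ offDiagPairs (n k), ((w k p.1 : ℝ) * w k p.2) ^ 2)
        ≤ ∑ i, (w k i : ℝ) ^ 2 := by
      refine Real.sqrt_le_iff.2 ⟨by positivity, ?_⟩
      calc ∑ p ∈ offDiagPairs (n k), ((w k p.1 : ℝ) * w k p.2) ^ 2
          ≤ ∑ p : Fin (n k) × Fin (n k), ((w k p.1 : ℝ) * w k p.2) ^ 2 :=
            Finset.sum_le_univ_sum_of_nonneg fun _ => sq_nonneg _
        _ = (∑ i, (w k i : ℝ) ^ 2) ^ 2 := by
            rw [pow_two (∑ i, _), Finset.sum_mul_sum, Fintype.sum_prod_type]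
            simp only [mul_pow]
    rw [abs_of_nonneg (by positivity), IsRegularWeights.scaledSq]
    calc _ ≤ √(m k) / (m k * ((m k : ℝ) - 1)) * (√(2 * H.degSq) * ∑ i, (w k i : ℝ) ^ 2) := by
          gcongr
      _ = _ := by ring
  -- The degenerate part of `U_n` itself is of order `1/n`; multiplied by `√m` it vanishes, again
  -- because `m = o(n²)`.
  have h4 : TendstoInMeasure μ (fun k ω => -(√(m k) / (n k * ((n k : ℝ) - 1))) *
      ∑ p ∈ offDiagPairs (n k), (1 : ℝ) * H.deg (X p.1 ω) (X p.2 ω)) atTop (fun _ => 0) := by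
    have hb := W.tendsto_sqrt_div_sub_one.const_mul (√(2 * H.degSq))
    rw [mul_zero] at hb
    refine tendstoInMeasure_const_mul_zero ?_ hb
    filter_upwards [hev] with k ⟨hn, _⟩
    have hn2 : (2 : ℝ) ≤ n k := by exact_mod_cast hn
    have hn1 : (0 : ℝ) < (n k : ℝ) - 1 := by linarith
    refine ⟨(H.memLp_sum_deg fun _ => 1).integrable (by norm_num),
      (mul_le_mul_of_nonneg_left (H.integral_abs_sum_deg_le fun _ => 1) (abs_nonneg _)).trans ?_⟩
    have hsum : √(∑ p ∈ offDiagPairs (n k), (1 : ℝ) ^ 2) ≤ n k := by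
      refine Real.sqrt_le_iff.2 ⟨by positivity, ?_⟩
      calc ∑ p ∈ offDiagPairs (n k), (1 : ℝ) ^ 2
          ≤ ∑ p : Fin (n k) × Fin (n k), (1 : ℝ) ^ 2 :=
            Finset.sum_le_univ_sum_of_nonneg fun _ => sq_nonneg _
        _ = (n k : ℝ) ^ 2 := by simp [sq]
    rw [abs_neg, abs_of_nonneg (by positivity)]
    calc _ ≤ √(m k) / (n k * ((n k : ℝ) - 1)) * (√(2 * H.degSq) * n k) := by gcongr
      _ = _ := by field_simp
  refine (tendstoInMeasure_add_zero (tendstoInMeasure_add_zero (tendstoInMeasure_add_zero h1 h2)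
    h3) h4).congr' ?_ (ae_eq_refl _)
  filter_upwards [hev] with k ⟨hn, hm⟩
  refine ae_of_all _ fun ω => ?_
  exact (weightedU_sub_uStat_eq (sample X (n k) ω) (μ.map (X 0)) (w k) (W.sum_eq k) hn hm).symm

end IIDKernel

/-- The two terms come from the change of normalization and from the diagonal; with integrable
entries each is of order `1/n` in `L¹`. -/
lemma vStat_sub_uStat_eq {h : ℝ → ℝ → ℝ} {n : ℕ} (hn : 2 ≤ n) (x : Fin n → ℝ) :
    vStat h x - uStat h x = -(1 / ((n : ℝ) ^ 2 * (n - 1)))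
        * ∑ p ∈ IIDKernel.offDiagPairs n, (1 : ℝ) * h (x p.1) (x p.2)
      + 1 / (n : ℝ) ^ 2 * ∑ i, (1 : ℝ) * h (x i) (x i) := by
  have hn2 : (2 : ℝ) ≤ n := by exact_mod_cast hn
  have hn0 : (n : ℝ) ≠ 0 := by linarith
  have hn1 : (n : ℝ) - 1 ≠ 0 := by linarith
  have e : ∑ i, ∑ j, h (x i) (x j)
      = ∑ p ∈ IIDKernel.offDiagPairs n, h (x p.1) (x p.2) + ∑ i, h (x i) (x i) := by
    rw [sum_offDiagPairs fun i j => h (x i) (x j), ← Finset.sum_add_distrib]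
    refine Finset.sum_congr rfl fun i _ => ?_
    rw [rowSum]
    have : ∀ j, h (x i) (x j) = (if i ≠ j then h (x i) (x j) else 0)
        + if i = j then h (x i) (x j) else 0 := by
      intro j; by_cases hij : i = j <;> simp [hij]
    rw [Finset.sum_congr rfl fun j _ => this j, Finset.sum_add_distrib, Finset.sum_ite_eq,
      if_pos (Finset.mem_univ i)]
  have hU : uStat h x = (∑ p ∈ IIDKernel.offDiagPairs n, h (x p.1) (x p.2))
      / ((n : ℝ) * ((n : ℝ) - 1)) := rfl
  rw [vStat, e, hU]
  simp only [one_mul]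
  field_simp
  ring

lemma tendsto_measureReal_le_of_slutsky {Ω : Type*} [MeasurableSpace Ω] {μ : Measure Ω}
    [IsProbabilityMeasure μ] {Z R F : ℕ → Ω → ℝ}
    (hZ : TendstoInDistribution Z atTop (id : ℝ → ℝ) (fun _ => μ) (gaussianReal 0 1))
    (hR : TendstoInMeasure μ R atTop (fun _ => 0)) (hRm : ∀ k, AEMeasurable (R k) μ)
    (hF : TendstoInMeasure μ F atTop (fun _ => 1)) (hFm : ∀ k, AEMeasurable (F k) μ) (t : ℝ) :
    Tendsto (fun k => μ.real {ω | (Z k ω + R k ω) * F k ω ≤ t}) atTop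
      (𝓝 (cdf (gaussianReal 0 1) t)) := by
  have hfin := (hZ.add_of_tendstoInMeasure_const hR
    hRm).continuous_comp_prodMk_of_tendstoInMeasure_const
    (g := fun p : ℝ × ℝ => p.1 * p.2) (by fun_prop) hF hFm
  simp only [add_zero, mul_one] at hfin
  exact tendsto_measureReal_le_of_tendstoInDistribution hfin t

/-- Here `s = √m`, `G` is the linear sum and `N` the numerator. Division by zero gives zero on both
sides, so vanishing `J` or `S` need not be excluded. -/
lemma studentized_eq {σ s : ℝ} (hσ : σ ≠ 0) (hs : s ≠ 0) (J S G N : ℝ) :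
    (G / σ + (2 * σ)⁻¹ * (s * N - 2 * G)) * (σ / (J * S)) = N / (2 * J * (S / s)) := by
  rw [show G / σ + (2 * σ)⁻¹ * (s * N - 2 * G) = s * N / (2 * σ) by field_simp; ring]
  by_cases hJ : J = 0
  · simp [hJ]
  by_cases hSz : S = 0
  · simp [hSz]
  field_simp

/-! ### Diagonal terms and the Studentized limit for deterministic weights. -/

namespace IIDKernel

variable {Ω : Type*} [MeasurableSpace Ω] {μ : Measure Ω}
  {h : ℝ → ℝ → ℝ} {X : ℕ → Ω → ℝ} {n m : ℕ → ℕ} {w : ∀ k, Fin (n k) → ℕ}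

lemma measurable_diag (H : IIDKernel μ h X) : Measurable fun x => h x x :=
  H.meas.comp (measurable_id.prodMk measurable_id)

lemma measurable_sample (H : IIDKernel μ h X) (n : ℕ) : Measurable (sample X n) :=
  measurable_pi_lambda _ fun i => H.meas_X i

lemma measurable_eval_kernel (H : IIDKernel μ h X) {n : ℕ} (i j : Fin n) :
    Measurable fun x : Fin n → ℝ => h (x i) (x j) := by
  have hp : Measurable fun x : Fin n → ℝ => (x i, x j) := by fun_prop
  exact H.meas.comp hp

lemma measurable_uStat (H : IIDKernel μ h X) (n : ℕ) :
    Measurable fun x : Fin n → ℝ => uStat h x := by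
  unfold uStat
  exact (Finset.measurable_fun_sum _ fun p _ => H.measurable_eval_kernel p.1 p.2).div_const _

lemma measurable_vStat (H : IIDKernel μ h X) (n : ℕ) :
    Measurable fun x : Fin n → ℝ => vStat h x := by
  unfold vStat
  exact (Finset.measurable_fun_sum _ fun i _ => Finset.measurable_fun_sum _ fun j _ =>
    H.measurable_eval_kernel i j).div_const _

lemma measurable_jackknifeVar (H : IIDKernel μ h X) (n : ℕ) :
    Measurable fun x : Fin n → ℝ => jackknifeVar h x := by
  have hD : ∀ i, Measurable fun x : Fin n → ℝ => uStatDelete h x i := fun i => by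
    unfold uStatDelete
    exact (Finset.measurable_fun_sum _ fun p _ => H.measurable_eval_kernel p.1 p.2).div_const _
  unfold jackknifeVar
  exact (Finset.measurable_fun_sum _ fun i _ =>
    ((hD i).sub (H.measurable_uStat n)).pow_const 2).const_mul _

lemma measurable_weightedU (H : IIDKernel μ h X) {n : ℕ} (w : Fin n → ℕ) (m : ℕ) :
    Measurable fun x : Fin n → ℝ => weightedU h x w m := by
  unfold weightedU
  exact (Finset.measurable_fun_sum _ fun p _ =>
    (H.measurable_eval_kernel p.1 p.2).const_mul _).div_const _

variable [IsProbabilityMeasure μ]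

lemma integrable_kernel (H : IIDKernel μ h X) {i j : ℕ} (hij : i ≠ j) :
    Integrable (fun ω => h (X i ω) (X j ω)) μ ∧
      ∫ ω, |h (X i ω) (X j ω)| ∂μ = ∫ ω, |h (X 0 ω) (X 1 ω)| ∂μ := by
  have := H.isProbabilityMeasure_law
  refine ⟨(H.memLp_kernel.comp_measurePreserving
    (H.measurePreserving_pair hij)).integrable (by norm_num), ?_⟩
  have hm : Measurable fun p : ℝ × ℝ => |h p.1 p.2| := H.meas.abs
  have e : ∀ {i j : ℕ}, i ≠ j → ∫ ω, |h (X i ω) (X j ω)| ∂μ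
      = ∫ p, |h p.1 p.2| ∂((μ.map (X 0)).prod (μ.map (X 0))) := by
    intro i j hij
    have hp := H.measurePreserving_pair hij
    conv_rhs => rw [← hp.map_eq]
    rw [integral_map hp.aemeasurable hm.aestronglyMeasurable]
  rw [e hij, e zero_ne_one]

/-- The diagonal terms of the `v`-statistics are asymptotically negligible. -/
theorem tendstoInMeasure_diag (H : IIDKernel μ h X) (W : IsRegularWeights n m w)
    (hd : Integrable (fun ω => h (X 0 ω) (X 0 ω)) μ) {e : ∀ k, Fin (n k) → ℝ}
    (he0 : ∀ k i, 0 ≤ e k i) (he : ∀ k i, e k i ≤ (w k i : ℝ) ^ 2) :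
    TendstoInMeasure μ (fun k ω => √(m k) * ((∑ i, e k i * h (X i ω) (X i ω)) /
        ((m k : ℝ) * (m k - 1))
        - (vStat h (sample X (n k) ω) - uStat h (sample X (n k) ω)))) atTop (fun _ => 0) := by
  have hev : ∀ᶠ k in atTop, 2 ≤ n k ∧ 2 ≤ m k :=
    (W.tendsto_n.eventually_ge_atTop 2).and (W.tendsto_m.eventually_ge_atTop 2)
  have hint : ∀ i, Integrable (fun ω => h (X i ω) (X i ω)) μ := fun i =>
    ((H.ident i).comp H.measurable_diag).integrable_iff.2 hd
  have habs : ∀ i, ∫ ω, |h (X i ω) (X i ω)| ∂μ ≤ ∫ ω, |h (X 0 ω) (X 0 ω)| ∂μ := fun i =>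
    (H.integral_abs_comp H.measurable_diag i).le
  have hC0 : 0 ≤ ∫ ω, |h (X 0 ω) (X 0 ω)| ∂μ := integral_nonneg fun _ => abs_nonneg _
  have hC1 : 0 ≤ ∫ ω, |h (X 0 ω) (X 1 ω)| ∂μ := integral_nonneg fun _ => abs_nonneg _
  have h1 : TendstoInMeasure μ (fun k ω => √(m k) / ((m k : ℝ) * (m k - 1)) *
      ∑ i, e k i * h (X i ω) (X i ω)) atTop (fun _ => 0) := by
    have hb := W.tendsto_scaledSq.const_mul (∫ ω, |h (X 0 ω) (X 0 ω)| ∂μ)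
    rw [mul_zero] at hb
    refine tendstoInMeasure_const_mul_zero ?_ hb
    filter_upwards [hev] with k ⟨_, hm⟩
    have hm2 : (2 : ℝ) ≤ m k := by exact_mod_cast hm
    have hm1 : (0 : ℝ) < (m k : ℝ) - 1 := by linarith
    have hs := integral_abs_sum_mul_le (μ := μ) Finset.univ
      (F := fun (i : Fin (n k)) ω => h (X i ω) (X i ω)) (b := e k)
      (fun i _ => hint i) (fun i _ => habs i) (fun i _ => he0 k i)
    refine ⟨hs.1, (mul_le_mul_of_nonneg_left hs.2 (abs_nonneg _)).trans ?_⟩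
    rw [abs_of_nonneg (by positivity), IsRegularWeights.scaledSq]
    calc _ ≤ √(m k) / ((m k : ℝ) * (m k - 1)) * ((∫ ω, |h (X 0 ω) (X 0 ω)| ∂μ) *
          ∑ i, (w k i : ℝ) ^ 2) := by gcongr; exact he k _
      _ = _ := by ring
  have h2 : TendstoInMeasure μ (fun k ω => √(m k) / ((n k : ℝ) ^ 2 * (n k - 1)) *
      ∑ p ∈ offDiagPairs (n k), (1 : ℝ) * h (X p.1 ω) (X p.2 ω)) atTop (fun _ => 0) := by
    have hb := W.tendsto_sqrt_div_sub_one.const_mul (∫ ω, |h (X 0 ω) (X 1 ω)| ∂μ)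
    rw [mul_zero] at hb
    refine tendstoInMeasure_const_mul_zero ?_ hb
    filter_upwards [hev] with k ⟨hn, _⟩
    have hn2 : (2 : ℝ) ≤ n k := by exact_mod_cast hn
    have hn1 : (0 : ℝ) < (n k : ℝ) - 1 := by linarith
    have hne : ∀ p ∈ offDiagPairs (n k), (p.1 : ℕ) ≠ p.2 := fun p hp hc =>
      mem_offDiagPairs.1 hp (Fin.ext hc)
    have hs := integral_abs_sum_mul_le (μ := μ) (offDiagPairs (n k))
      (F := fun (p : Fin (n k) × Fin (n k)) ω => h (X p.1 ω) (X p.2 ω)) (b := fun _ => 1)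
      (fun p hp => (H.integrable_kernel (hne p hp)).1)
      (fun p hp => (H.integrable_kernel (hne p hp)).2.le) (fun _ _ => zero_le_one)
    refine ⟨hs.1, (mul_le_mul_of_nonneg_left hs.2 (abs_nonneg _)).trans ?_⟩
    have hsum : ∑ p ∈ offDiagPairs (n k), (1 : ℝ) ≤ (n k : ℝ) ^ 2 :=
      calc ∑ p ∈ offDiagPairs (n k), (1 : ℝ) ≤ ∑ p : Fin (n k) × Fin (n k), (1 : ℝ) :=
            Finset.sum_le_univ_sum_of_nonneg fun _ => zero_le_one
        _ = (n k : ℝ) ^ 2 := by simp [sq]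
    rw [abs_of_nonneg (by positivity)]
    calc _ ≤ √(m k) / ((n k : ℝ) ^ 2 * (n k - 1)) * ((∫ ω, |h (X 0 ω) (X 1 ω)| ∂μ) *
          (n k : ℝ) ^ 2) := by gcongr
      _ = _ := by field_simp
  have h3 : TendstoInMeasure μ (fun k ω => -(√(m k) / (n k : ℝ) ^ 2) *
      ∑ i : Fin (n k), (1 : ℝ) * h (X i ω) (X i ω)) atTop (fun _ => 0) := by
    have hb := W.tendsto_sqrt_div.const_mul (∫ ω, |h (X 0 ω) (X 0 ω)| ∂μ)
    rw [mul_zero] at hb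
    refine tendstoInMeasure_const_mul_zero ?_ hb
    filter_upwards [hev] with k ⟨hn, _⟩
    have hn0 : (n k : ℝ) ≠ 0 := by positivity
    have hs := integral_abs_sum_mul_le (μ := μ) Finset.univ
      (F := fun (i : Fin (n k)) ω => h (X i ω) (X i ω)) (b := fun _ => 1)
      (fun i _ => hint i) (fun i _ => habs i) (fun _ _ => zero_le_one)
    refine ⟨hs.1, (mul_le_mul_of_nonneg_left hs.2 (abs_nonneg _)).trans (le_of_eq ?_)⟩
    rw [abs_neg, abs_of_nonneg (by positivity)]
    simp only [Finset.sum_const, Finset.card_univ, Fintype.card_fin, nsmul_eq_mul, mul_one]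
    field_simp
  refine (tendstoInMeasure_add_zero (tendstoInMeasure_add_zero h1 h2) h3).congr' ?_
    (ae_eq_refl _)
  filter_upwards [hev] with k ⟨hn, _⟩
  refine ae_of_all _ fun ω => ?_
  simp only [vStat_sub_uStat_eq hn]
  simp only [sample]
  ring

/-- Continuous mapping at the point `(σ, 1)`, where the denominator does not vanish since `σ > 0`.
-/
lemma tendstoInMeasure_studentizing (H : IIDKernel μ h X) (hσ : 0 < H.sigmaSq)
    (W : IsRegularWeights n m w) :
    TendstoInMeasure μ (fun k ω => √H.sigmaSq / (√(jackknifeVar h (sample X (n k) ω)) *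
      √(∑ i, W.std k i ^ 2))) atTop (fun _ => (1 : ℝ)) := by
  have hσpos : 0 < √H.sigmaSq := Real.sqrt_pos.2 hσ
  have hS := (Real.continuous_sqrt.tendsto 1).comp W.tendsto_sum_std_sq
  rw [Real.sqrt_one] at hS
  have hp := TendstoInMeasure.prodMk_const (H.tendstoInMeasure_sqrt_jackknifeVar W.tendsto_n)
    (tendstoInMeasure_const_of_tendsto (μ := μ) hS)
  have hc : ContinuousAt (fun p : ℝ × ℝ => √H.sigmaSq / (p.1 * p.2)) (√H.sigmaSq, 1) :=
    ContinuousAt.div continuousAt_const (by fun_prop) (by simpa using hσpos.ne')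
  have := TendstoInMeasure.comp_continuousAt hp hc
  simp only [mul_one, div_self hσpos.ne'] at this
  exact this

lemma tendstoInDistribution_sum_std_mul (H : IIDKernel μ h X) (hσ : 0 < H.sigmaSq)
    (W : IsRegularWeights n m w) :
    TendstoInDistribution (fun k ω => ∑ i, W.std k i * (H.g (X i ω) / √H.sigmaSq)) atTop
      (id : ℝ → ℝ) (fun _ => μ) (gaussianReal 0 1) := by
  have hgσ : Measurable fun x => H.g x / √H.sigmaSq := H.measurable_g.div_const _
  refine tendstoInDistribution_weighted_sum (ξ := fun i ω => H.g (X i ω) / √H.sigmaSq)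
    (fun i => hgσ.comp (H.meas_X i)) (H.indep.comp (fun _ x => H.g x / √H.sigmaSq) fun _ => hgσ)
    (fun i => (H.ident i).comp hgσ) ?_ ?_ W.tendsto_sum_std_sq
    fun ε hε => W.eventually_abs_std_le hε
  · rw [integral_div, H.integral_g, zero_div]
  · simp only [Pi.pow_apply, div_pow]
    rw [integral_div, Real.sq_sqrt hσ.le]
    exact div_self hσ.ne'

/-- Conditional central limit theorem for Studentized weighted statistics that are asymptotically
weighted sums of the projections, for deterministic weights. -/
theorem tendsto_measureReal_studentized (H : IIDKernel μ h X) (hσ : 0 < H.sigmaSq)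
    (W : IsRegularWeights n m w) {num : ∀ k, (Fin (n k) → ℝ) → ℝ}
    (hnum : ∀ k, Measurable (num k))
    (hrem : TendstoInMeasure μ (fun k ω => √(m k) * num k (sample X (n k) ω)
        - 2 * ∑ i, W.std k i * H.g (X i ω)) atTop (fun _ => 0)) (t : ℝ) :
    Tendsto (fun k => μ.real {ω | num k (sample X (n k) ω) /
        (2 * √(jackknifeVar h (sample X (n k) ω)) *
          √(∑ i, ((w k i : ℝ) / (m k : ℝ) - 1 / (n k : ℝ)) ^ 2)) ≤ t})
      atTop (𝓝 (cdf (gaussianReal 0 1) t)) := by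
  have hσpos : 0 < √H.sigmaSq := Real.sqrt_pos.2 hσ
  have hgX : ∀ i, Measurable fun ω => H.g (X i ω) := fun i => H.measurable_g.comp (H.meas_X i)
  have hnumX : ∀ k, Measurable fun ω => num k (sample X (n k) ω) := fun k =>
    (hnum k).comp (measurable_sample H _)
  have hjX : ∀ k, Measurable fun ω => jackknifeVar h (sample X (n k) ω) := fun k =>
    (H.measurable_jackknifeVar _).comp (measurable_sample H _)
  have hRm : ∀ k, AEMeasurable (fun ω => (2 * √H.sigmaSq)⁻¹ *
      (√(m k) * num k (sample X (n k) ω) - 2 * ∑ i, W.std k i * H.g (X i ω))) μ := fun k => by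
    have h1 : Measurable fun ω => ∑ i, W.std k i * H.g (X i ω) :=
      Finset.measurable_fun_sum _ fun i _ => (hgX i).const_mul _
    exact ((((hnumX k).const_mul _).sub (h1.const_mul 2)).const_mul _).aemeasurable
  have hR0 : TendstoInMeasure μ (fun k ω => (2 * √H.sigmaSq)⁻¹ * (√(m k) *
      num k (sample X (n k) ω) - 2 * ∑ i, W.std k i * H.g (X i ω))) atTop (fun _ => 0) := by
    rw [← mul_zero (2 * √H.sigmaSq)⁻¹]
    exact TendstoInMeasure.comp_continuousAt hrem
      (f := fun x => (2 * √H.sigmaSq)⁻¹ * x) (continuous_const_mul _).continuousAt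
  have hFm : ∀ k, AEMeasurable (fun ω => √H.sigmaSq / (√(jackknifeVar h (sample X (n k) ω)) *
      √(∑ i, W.std k i ^ 2))) μ := fun k =>
    (((hjX k).sqrt.mul_const _).const_div _).aemeasurable
  refine (tendsto_measureReal_le_of_slutsky (H.tendstoInDistribution_sum_std_mul hσ W) hR0 hRm
    (H.tendstoInMeasure_studentizing hσ W) hFm t).congr' ?_
  filter_upwards [W.tendsto_m.eventually_ge_atTop 1] with k hm
  have hm0 : (0 : ℝ) < m k := by exact_mod_cast hm
  have hs0 : 0 < √(m k : ℝ) := Real.sqrt_pos.2 hm0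
  have hS : √(∑ i, ((w k i : ℝ) / (m k : ℝ) - 1 / (n k : ℝ)) ^ 2)
      = √(∑ i, W.std k i ^ 2) / √(m k) := by
    rw [← Real.sqrt_div' _ hm0.le, Finset.sum_div]
    congr 1
    refine Finset.sum_congr rfl fun i _ => ?_
    rw [IsRegularWeights.std, div_pow, Real.sq_sqrt hm0.le, div_div, ← pow_two, ← div_pow, sub_div]
    congr 2
    rw [div_div, mul_comm, ← div_div, div_self hm0.ne']
  have e : ∀ ω, (∑ i, W.std k i * (H.g (X i ω) / √H.sigmaSq))
      = (∑ i, W.std k i * H.g (X i ω)) / √H.sigmaSq := fun ω => by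
    rw [Finset.sum_div]
    exact Finset.sum_congr rfl fun i _ => (mul_div_assoc _ _ _).symm
  simp only [hS, e, studentized_eq hσpos.ne' hs0.ne']

end IIDKernel

/-! ### From draws to weights. -/

section Draws

variable {n m : ℕ}

lemma sum_comp_draws (d : Fin m → Fin n) (f : Fin n → ℝ) :
    ∑ s, f (d s) = ∑ i, (weight d i : ℝ) * f i := by
  simp only [weight_eq_sum, Nat.cast_sum, Finset.sum_mul]
  rw [Finset.sum_comm]
  simp

lemma sum_comp_draws₂ (d : Fin m → Fin n) (f : Fin n → Fin n → ℝ) :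
    ∑ s, ∑ t, f (d s) (d t) = ∑ i, ∑ j, (weight d i : ℝ) * (weight d j : ℝ) * f i j := by
  simp only [sum_comp_draws d (f _)]
  rw [sum_comp_draws d fun i => ∑ j, (weight d j : ℝ) * f i j]
  simp only [Finset.mul_sum, mul_assoc]

/-- The condition `s ≠ t` is implied by `d s ≠ d t`, so grouping the draws by index leaves exactly
the off-diagonal pairs. -/
lemma bootU_eq (h : ℝ → ℝ → ℝ) (x : Fin n → ℝ) (d : Fin m → Fin n) :
    bootU h x d = weightedU h x (weight d) m := by
  rw [bootU, weightedU, IIDKernel.offDiagPairs, Finset.sum_filter, Finset.sum_filter,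
    Fintype.sum_prod_type, Fintype.sum_prod_type]
  congr 1
  have h1 : ∀ s t : Fin m, (if s ≠ t ∧ d s ≠ d t then h (x (d s)) (x (d t)) else 0)
      = if d s ≠ d t then h (x (d s)) (x (d t)) else 0 := by
    intro s t
    by_cases hst : s = t
    · simp [hst]
    · simp [hst]
  simp only [h1]
  rw [sum_comp_draws₂ d fun i j => if i ≠ j then h (x i) (x j) else 0]
  simp only [mul_ite, mul_zero]

lemma sum_sum_weight_eq (h : ℝ → ℝ → ℝ) (x : Fin n → ℝ) (w : Fin n → ℕ) :
    ∑ i, ∑ j, (w i : ℝ) * (w j : ℝ) * h (x i) (x j)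
      = ∑ p ∈ IIDKernel.offDiagPairs n, (w p.1 : ℝ) * w p.2 * h (x p.1) (x p.2)
        + ∑ i, (w i : ℝ) ^ 2 * h (x i) (x i) := by
  rw [sum_offDiagPairs fun i j => (w i : ℝ) * w j * h (x i) (x j), ← Finset.sum_add_distrib]
  refine Finset.sum_congr rfl fun i _ => ?_
  rw [rowSum]
  have : ∀ j, (w i : ℝ) * w j * h (x i) (x j)
      = (if i ≠ j then (w i : ℝ) * w j * h (x i) (x j) else 0)
        + if i = j then (w i : ℝ) * w j * h (x i) (x j) else 0 := by
    intro j; by_cases hij : i = j <;> simp [hij]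
  rw [Finset.sum_congr rfl fun j _ => this j, Finset.sum_add_distrib, Finset.sum_ite_eq,
    if_pos (Finset.mem_univ i), pow_two]

lemma bootV_eq (h : ℝ → ℝ → ℝ) (x : Fin n → ℝ) (d : Fin m → Fin n) :
    bootV h x d = weightedU h x (weight d) m
      + (∑ i, (weight d i : ℝ) ^ 2 * h (x i) (x i)) / ((m : ℝ) * (m - 1)) := by
  rw [bootV, sum_sum_weight_eq, add_div, weightedU]

/-- Each index `i` accounts for `w_i` pairs of a draw with itself; removing them lowers the diagonal
coefficient from `w_i²` to `w_i² - w_i`. -/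
lemma bootV'_eq (h : ℝ → ℝ → ℝ) (x : Fin n → ℝ) (d : Fin m → Fin n) :
    bootV' h x d = weightedU h x (weight d) m
      + (∑ i, ((weight d i : ℝ) ^ 2 - weight d i) * h (x i) (x i)) / ((m : ℝ) * (m - 1)) := by
  rw [bootV', weightedU, ← add_div]
  congr 1
  rw [Finset.sum_filter, Fintype.sum_prod_type]
  have h1 : ∀ s t : Fin m, (if s ≠ t then h (x (d s)) (x (d t)) else 0)
      = h (x (d s)) (x (d t)) - if s = t then h (x (d s)) (x (d t)) else 0 := by
    intro s t
    by_cases hst : s = t <;> simp [hst]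
  simp only [h1, Finset.sum_sub_distrib, Finset.sum_ite_eq, Finset.mem_univ, if_true]
  rw [sum_comp_draws₂ d fun i j => h (x i) (x j), sum_comp_draws d fun i => h (x i) (x i),
    sum_sum_weight_eq]
  simp only [sub_mul, Finset.sum_sub_distrib]
  ring

lemma integral_comp_draws {Ω : Type*} [MeasurableSpace Ω] {μ : Measure Ω}
    {D : Ω → Fin m → Fin n} (hn : 1 ≤ n) (hD : Measurable D)
    (hu : μ.map D = uniformOn Set.univ) (f : (Fin m → Fin n) → ℝ) :
    ∫ ω, f (D ω) ∂μ = (∑ d, f d) / n ^ m := by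
  have : Nonempty (Fin n) := ⟨⟨0, hn⟩⟩
  have h1 : ∫ ω, f (D ω) ∂μ = ∫ d, f d ∂(μ.map D) :=
    (integral_map hD.aemeasurable (measurable_of_finite f).aestronglyMeasurable).symm
  rw [h1, hu, integral_fintype (Integrable.of_finite), Finset.sum_div]
  refine Finset.sum_congr rfl fun d _ => ?_
  rw [Measure.real, uniformOn_univ, Measure.count_singleton]
  simp [div_eq_inv_mul]

end Draws

/-! ### Random weights and conditional probabilities. -/

namespace IIDKernel

variable {Ω : Type*} [MeasurableSpace Ω] {μ : Measure Ω} [IsProbabilityMeasure μ]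
  {h : ℝ → ℝ → ℝ} {X : ℕ → Ω → ℝ}

/-- By independence the conditional expectation given `X_0` is `g(X_0)`, which would vanish almost
surely if its second moment did. -/
lemma sigmaSq_pos (H : IIDKernel μ h X) (hnd : NonDegenerate μ h X) : 0 < H.sigmaSq := by
  have hν := H.isProbabilityMeasure_law
  by_contra hc
  have h0 : H.sigmaSq = 0 := le_antisymm (not_lt.1 hc) (integral_nonneg fun _ => sq_nonneg _)
  have hg0 : ∀ᵐ ω ∂μ, H.g (X 0 ω) = 0 := by
    have h1 := (integral_eq_zero_iff_of_nonneg (fun _ => sq_nonneg _)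
      (H.memLp_g 0).integrable_sq).1 h0
    filter_upwards [h1] with ω hω
    simpa using hω
  refine hnd 0 1 zero_ne_one ?_
  set c := ∫ ω', h (X 0 ω') (X 1 ω') ∂μ with hc'
  have hcm : c = kernelMean h (μ.map (X 0)) := by
    have hp := H.measurePreserving_pair zero_ne_one
    have hm : Measurable fun p : ℝ × ℝ => h p.1 p.2 := H.meas
    rw [kernelMean]
    conv_rhs => rw [← hp.map_eq]
    rw [integral_map hp.aemeasurable hm.aestronglyMeasurable]
  have hm : Measurable fun p : ℝ × ℝ => h p.1 p.2 - c := H.meas.sub_const c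
  have hE := condExp_prod_of_indepFun (H.meas_X 0) (H.meas_X 1) (H.indep.indepFun zero_ne_one) hm
    ((H.integrable_kernel zero_ne_one).1.sub (integrable_const c))
  refine hE.trans ?_
  have hi : ∀ᵐ x ∂(μ.map (X 0)), Integrable (fun y => h x y) (μ.map (X 0)) :=
    (H.memLp_kernel.integrable (by norm_num)).prod_right_ae
  filter_upwards [hg0, ae_of_ae_map (H.meas_X 0).aemeasurable hi] with ω hω hiω
  rw [(H.ident 1).map_eq]
  change ∫ y, (h (X 0 ω) y - c) ∂(μ.map (X 0)) = 0
  rw [integral_sub hiω (integrable_const c)]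
  simpa [kernelProj, hcm] using hω

/-- The standardized weights of uniform draws are asymptotically regular. -/
lemma tendstoInMeasure_weightDefect {n m : ℕ → ℕ} (hn_pos : ∀ k, 1 ≤ n k)
    (hn : Tendsto n atTop atTop) (hm : Tendsto m atTop atTop)
    {D : (k : ℕ) → Ω → Fin (m k) → Fin (n k)} (hD_meas : ∀ k, Measurable (D k))
    (hD_unif : ∀ k, μ.map (D k) = uniformOn Set.univ) :
    TendstoInMeasure μ (fun k ω => weightDefect (D k ω)) atTop (fun _ => 0) := by
  refine tendstoInMeasure_zero_of_integral_abs_le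
    (b := fun k => 9 * (n k : ℝ)⁻¹ + (m k : ℝ)⁻¹) ?_ ?_
  · filter_upwards [hm.eventually_ge_atTop 1] with k hk
    refine ⟨Integrable.comp_measurable (g := weightDefect) Integrable.of_finite (hD_meas k), ?_⟩
    have hn0 : (0 : ℝ) < n k := by exact_mod_cast hn_pos k
    simp only [abs_of_nonneg (weightDefect_nonneg _)]
    rw [integral_comp_draws (hn_pos k) (hD_meas k) (hD_unif k), div_le_iff₀ (by positivity)]
    refine (sum_draws_weightDefect_le (hn_pos k) hk).trans (le_of_eq ?_)
    ring
  · have h1 : Tendsto (fun k => ((n k : ℝ))⁻¹) atTop (𝓝 0) :=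
      tendsto_inv_atTop_zero.comp (tendsto_natCast_atTop_atTop.comp hn)
    have h2 : Tendsto (fun k => ((m k : ℝ))⁻¹) atTop (𝓝 0) :=
      tendsto_inv_atTop_zero.comp (tendsto_natCast_atTop_atTop.comp hm)
    simpa using (h1.const_mul 9).add h2

lemma isRegularWeights_of_weightDefect {n m : ℕ → ℕ}
    (hn : Tendsto n atTop atTop) (hm : Tendsto m atTop atTop)
    (hmn : (fun k => (m k : ℝ)) =o[atTop] (fun k => (n k : ℝ) ^ 2))
    (d : (k : ℕ) → Fin (m k) → Fin (n k))
    (hd : Tendsto (fun k => weightDefect (d k)) atTop (𝓝 0)) :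
    IsRegularWeights n m (fun k => weight (d k)) where
  tendsto_n := hn
  tendsto_m := hm
  isLittleO := hmn
  sum_eq k := sum_weight (d k)
  sq := by
    have h1 : Tendsto (fun k => ((∑ i, centredWeight (d k) i ^ 2) / m k - 1) ^ 2) atTop (𝓝 0) :=
      squeeze_zero (fun _ => sq_nonneg _) (fun k => by
        rw [weightDefect]; exact le_add_of_nonneg_right (by positivity)) hd
    have h2 := (Real.continuous_sqrt.tendsto 0).comp h1
    rw [Real.sqrt_zero] at h2
    refine tendsto_sub_nhds_zero_iff.1 (squeeze_zero_norm (fun k => ?_) h2)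
    rw [Function.comp_apply, Real.sqrt_sq_eq_abs]
    rfl
  fourth := squeeze_zero (fun _ => by positivity) (fun k => by
        rw [weightDefect]; exact le_add_of_nonneg_left (sq_nonneg _)) hd

/-- Conditional central limit theorem given the weights, for Studentized functions of the sample
and the weights that are asymptotically weighted sums of the projections. -/
theorem tendstoInMeasure_condExp_studentized (H : IIDKernel μ h X) (hσ : 0 < H.sigmaSq)
    {n m : ℕ → ℕ} (hn_pos : ∀ k, 1 ≤ n k) (hn : Tendsto n atTop atTop)
    (hm : Tendsto m atTop atTop)
    (hmn : (fun k => (m k : ℝ)) =o[atTop] (fun k => (n k : ℝ) ^ 2))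
    {D : (k : ℕ) → Ω → Fin (m k) → Fin (n k)} (hD_meas : ∀ k, Measurable (D k))
    (hD_unif : ∀ k, μ.map (D k) = uniformOn Set.univ)
    (hD_indep : ∀ k, IndepFun (fun ω i => X i ω) (D k) μ)
    {num : ∀ k, (Fin (n k) → ℝ) → (Fin (n k) → ℕ) → ℝ}
    (hnum : ∀ k w, Measurable fun x => num k x w)
    (hrem : ∀ φ : ℕ → ℕ, Tendsto φ atTop atTop → ∀ w : ∀ k, Fin (n (φ k)) → ℕ,
      ∀ W : IsRegularWeights (fun k => n (φ k)) (fun k => m (φ k)) w,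
      TendstoInMeasure μ (fun k ω => √(m (φ k)) * num (φ k) (sample X (n (φ k)) ω) (w k)
        - 2 * ∑ i, W.std k i * H.g (X i ω)) atTop (fun _ => 0)) (t : ℝ) :
    TendstoInMeasure μ (fun k => μ⟦{ω | num k (sample X (n k) ω) (weight (D k ω))
        / normalizer h (sample X (n k) ω) (D k ω) ≤ t} | sigmaWeights (D k)⟧)
      atTop (fun _ => cdf (gaussianReal 0 1) t) := by
  -- The conditional probability as a function of frozen weights.
  set p : ∀ k, (Fin (n k) → ℕ) → ℝ := fun k w => μ.real {ω | num k (sample X (n k) ω) w /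
    (2 * √(jackknifeVar h (sample X (n k) ω)) *
      √(∑ i, ((w i : ℝ) / (m k : ℝ) - 1 / (n k : ℝ)) ^ 2)) ≤ t} with hp
  have hV : ∀ k, Measurable fun ω => weight (D k ω) := fun k =>
    (measurable_of_finite fun d => weight d).comp (hD_meas k)
  have hY : Measurable fun ω i => X i ω := measurable_pi_lambda _ H.meas_X
  have hcond : ∀ k, μ⟦{ω | num k (sample X (n k) ω) (weight (D k ω))
        / normalizer h (sample X (n k) ω) (D k ω) ≤ t} | sigmaWeights (D k)⟧
      =ᵐ[μ] fun ω => p k (weight (D k ω)) := by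
    intro k
    set S : (Fin (n k) → ℕ) → Set (ℕ → ℝ) := fun w => {y | num k (fun i => y i) w /
      (2 * √(jackknifeVar h fun i : Fin (n k) => y i) *
        √(∑ i, ((w i : ℝ) / (m k : ℝ) - 1 / (n k : ℝ)) ^ 2)) ≤ t} with hS
    have hr : Measurable fun (y : ℕ → ℝ) (i : Fin (n k)) => y i :=
      measurable_pi_lambda _ fun i => measurable_pi_apply _
    have hSm : ∀ w, MeasurableSet (S w) := fun w =>
      measurableSet_le (((hnum k w).comp hr).div
        (((((H.measurable_jackknifeVar (n k)).comp hr).sqrt).const_mul 2).mul_const _))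
        measurable_const
    have hind : IndepFun (fun ω => weight (D k ω)) (fun ω i => X i ω) μ :=
      (hD_indep k).symm.comp (φ := fun d => weight d) (ψ := id) (measurable_of_finite _)
        measurable_id
    exact condExp_indicator_of_indepFun (hV k) hY hind hSm
  refine TendstoInMeasure.congr_left (fun k => (hcond k).symm) ?_
  -- Subsequence principle. The further subsequence makes `weightDefect` converge almost surely;
  -- fixing such an `ω` gives deterministic regular weights. Hence `hrem` is required along every
  -- `φ`.
  refine (exists_seq_tendstoInMeasure_atTop_iff (f := fun k ω => p k (weight (D k ω))) fun k =>
    ((measurable_of_countable (p k)).comp (hV k)).aestronglyMeasurable).2 fun ns hns => ?_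
  obtain ⟨ns', hns', hae⟩ := ((tendstoInMeasure_weightDefect hn_pos hn hm hD_meas
    hD_unif).comp hns.tendsto_atTop).exists_seq_tendsto_ae
  refine ⟨ns', hns', ?_⟩
  filter_upwards [hae] with ω hω
  have hφ : Tendsto (fun j => ns (ns' j)) atTop atTop :=
    hns.tendsto_atTop.comp hns'.tendsto_atTop
  have W := isRegularWeights_of_weightDefect (hn.comp hφ) (hm.comp hφ) (hmn.comp_tendsto hφ)
    (fun j => D (ns (ns' j)) ω) hω
  exact H.tendsto_measureReal_studentized hσ W
    (num := fun j x => num (ns (ns' j)) x (weight (D (ns (ns' j)) ω)))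
    (fun j => hnum _ _) (hrem _ hφ _ W) t

end IIDKernel

end BootstrapU

/-! ### Assembly of the three limits. -/

theorem mainTheorem1 {Ω : Type*} [MeasurableSpace Ω] (μ : Measure Ω) [IsProbabilityMeasure μ]
    (h : ℝ → ℝ → ℝ) (h_meas : Measurable (Function.uncurry h)) (h_symm : ∀ x y, h x y = h y x)
    (X : ℕ → Ω → ℝ) (hX_meas : ∀ i, Measurable (X i)) (hX_indep : iIndepFun X μ)
    (hX_ident : ∀ i, IdentDistrib (X i) (X 0) μ μ)
    (h_nondeg : BootstrapU.NonDegenerate μ h X)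
    (n m : ℕ → ℕ) (hn_pos : ∀ k, 1 ≤ n k)
    (hn : Tendsto n atTop atTop) (hm : Tendsto m atTop atTop)
    (hmn : (fun k => (m k : ℝ)) =o[atTop] (fun k => (n k : ℝ) ^ 2))
    (D : (k : ℕ) → Ω → Fin (m k) → Fin (n k)) (hD_meas : ∀ k, Measurable (D k))
    (hD_unif : ∀ k, μ.map (D k) = uniformOn Set.univ)
    (hD_indep : ∀ k, IndepFun (fun ω i => X i ω) (D k) μ)
    (h_sq : Integrable (fun ω => h (X 0 ω) (X 1 ω) ^ 2) μ) :
    (∀ t : ℝ, TendstoInMeasure μ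
      (fun k => μ⟦{ω | (BootstrapU.bootU h (BootstrapU.sample X (n k) ω) (D k ω)
            - BootstrapU.uStat h (BootstrapU.sample X (n k) ω))
          / BootstrapU.normalizer h (BootstrapU.sample X (n k) ω) (D k ω) ≤ t} |
        BootstrapU.sigmaWeights (D k)⟧)
      atTop (fun _ => cdf (gaussianReal 0 1) t)) ∧
    (Integrable (fun ω => h (X 0 ω) (X 0 ω) ^ 2) μ →
      (∀ t : ℝ, TendstoInMeasure μ
        (fun k => μ⟦{ω | (BootstrapU.bootV h (BootstrapU.sample X (n k) ω) (D k ω)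
              - BootstrapU.vStat h (BootstrapU.sample X (n k) ω))
            / BootstrapU.normalizer h (BootstrapU.sample X (n k) ω) (D k ω) ≤ t} |
          BootstrapU.sigmaWeights (D k)⟧)
        atTop (fun _ => cdf (gaussianReal 0 1) t)) ∧
      (∀ t : ℝ, TendstoInMeasure μ
        (fun k => μ⟦{ω | (BootstrapU.bootV' h (BootstrapU.sample X (n k) ω) (D k ω)
              - BootstrapU.vStat h (BootstrapU.sample X (n k) ω))
            / BootstrapU.normalizer h (BootstrapU.sample X (n k) ω) (D k ω) ≤ t} |
          BootstrapU.sigmaWeights (D k)⟧)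
        atTop (fun _ => cdf (gaussianReal 0 1) t))) := by
  have H : BootstrapU.IIDKernel μ h X := ⟨h_meas, h_symm, hX_meas, hX_indep, hX_ident, h_sq⟩
  have hσ := H.sigmaSq_pos h_nondeg
  -- Both `v`-versions differ from the weighted `u`-statistic by a diagonal with coefficients `e
  -- (w_i)`, where `e a` is `a²` or `a² - a`; only `0 ≤ e a ≤ a²` matters.
  have hdiag : ∀ e : ℕ → ℝ, (∀ a, 0 ≤ e a) → (∀ a, e a ≤ (a : ℝ) ^ 2) →
      Integrable (fun ω => h (X 0 ω) (X 0 ω) ^ 2) μ → ∀ t : ℝ, TendstoInMeasure μ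
      (fun k => μ⟦{ω | (BootstrapU.weightedU h (BootstrapU.sample X (n k) ω)
            (BootstrapU.weight (D k ω)) (m k)
            + (∑ i, e (BootstrapU.weight (D k ω) i) * h (BootstrapU.sample X (n k) ω i)
                (BootstrapU.sample X (n k) ω i)) / ((m k : ℝ) * (m k - 1))
            - BootstrapU.vStat h (BootstrapU.sample X (n k) ω))
          / BootstrapU.normalizer h (BootstrapU.sample X (n k) ω) (D k ω) ≤ t} |
        BootstrapU.sigmaWeights (D k)⟧)
      atTop (fun _ => cdf (gaussianReal 0 1) t) := by
    intro e he0 he hd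
    have hd1 : Integrable (fun ω => h (X 0 ω) (X 0 ω)) μ :=
      ((memLp_two_iff_integrable_sq (H.measurable_diag.comp (hX_meas 0)).aestronglyMeasurable).2
        hd).integrable (by norm_num)
    refine H.tendstoInMeasure_condExp_studentized hσ hn_pos hn hm hmn hD_meas hD_unif hD_indep
      (num := fun k x w => BootstrapU.weightedU h x w (m k)
        + (∑ i, e (w i) * h (x i) (x i)) / ((m k : ℝ) * (m k - 1)) - BootstrapU.vStat h x)
      (fun k w => ?_) (fun φ hφ w W => ?_)
    · exact ((H.measurable_weightedU w (m k)).add ((Finset.measurable_fun_sum _ fun i _ =>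
        (H.measurable_eval_kernel i i).const_mul _).div_const _)).sub (H.measurable_vStat (n k))
    · have h1 := H.tendstoInMeasure_weightedU_remainder W
      have h2 := H.tendstoInMeasure_diag W hd1 (e := fun k i => e (w k i))
        (fun k i => he0 _) (fun k i => he _)
      refine (BootstrapU.tendstoInMeasure_add_zero h1 h2).congr_left fun k =>
        ae_of_all _ fun ω => ?_
      simp only [BootstrapU.sample]
      ring
  refine ⟨?_, fun hd => ⟨?_, ?_⟩⟩
  · simp only [BootstrapU.bootU_eq]
    exact H.tendstoInMeasure_condExp_studentized hσ hn_pos hn hm hmn hD_meas hD_unif hD_indep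
      (num := fun k x w => BootstrapU.weightedU h x w (m k) - BootstrapU.uStat h x)
      (fun k w => (H.measurable_weightedU w (m k)).sub (H.measurable_uStat (n k)))
      (fun φ hφ w W => H.tendstoInMeasure_weightedU_remainder W)
  · simp only [BootstrapU.bootV_eq]
    exact hdiag (fun a => (a : ℝ) ^ 2) (fun _ => sq_nonneg _) (fun _ => le_rfl) hd
  · simp only [BootstrapU.bootV'_eq]
    refine hdiag (fun a => (a : ℝ) ^ 2 - a) (fun a => ?_) (fun a => ?_) hd
    · rw [sub_nonneg]
      exact_mod_cast Nat.le_self_pow two_ne_zero a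
    · exact sub_le_self _ (Nat.cast_nonneg a)
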